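/- **Theorem.** Let $X(t)=m+Y(t)$, $t\in\mathbb Z$, where $m$ is a constant and $Y$ is a (real- or complex-valued) zero-mean wide-sense stationary process with spectral density $f$ on $[-\pi,\pi]$, that is, $E\big[Y(s+t)\overline{Y(s)}\big]=\int_{-\pi}^{\pi}e^{it\lambda}f(\lambda)\,d\lambda$ for all $s,t\in\mathbb Z$. Let $f=f_\alpha g$, where $\alpha>-1/2$ and $$f_\alpha(\lambda)=(2\pi)^{-1}|1-e^{i\lambda}|^{2\alpha},\qquad g(\lambda)=h(\lambda)\prod_{i=1}^{r}|\lambda-\lambda_i|^{\alpha(i)}\quad(\lambda\in[-\pi,\pi]),$$ with finitely many points $\lambda_i\in[-\pi,\pi]$, exponents $\alpha(i)\ge 0$, and $h$ measurable, bounded, bounded below by a positive constant on $[-\pi,\pi]$, and continuous at $0$ (the class $ZB_0^+$). Assume $g(0)>0$. For weights $c=(c_0,\dots,c_n)$ (real if $X$ is real-valued, complex if $X$ is complex-valued) with $\sum_{k=0}^n c_k=1$, the linear unbiased estimator $\sum_{k=0}^n c_kX(k)$ of $m$ has variance $E\big|\sum_{k=0}^n c_kX(k)-m\big|^2$. The best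 linear unbiased estimator (BLUE) $\widehat m_{BLU}$ based on $X(0),\dots,X(n)$ is the one of minimal variance; for every $n\ge0$ it exists and its weights are unique. Its variance satisfies $$\operatorname{Var}_f(\widehat m_{BLU})\sim n^{-2\alpha-1}\,\frac{\Gamma(2\alpha+1)\,g(0)}{B(\alpha+1,\alpha+1)}\qquad(n\to\infty).$$ Moreover, let $\widehat m_{\alpha}=\sum_{k=0}^n c_k(n,\alpha)X(k)$ with $$c_k(n,\alpha)=\binom nk\frac{B(\alpha+k+1,\alpha+n-k+1)}{B(\alpha+1,\alpha+1)},\qquad k=0,\dots,n.$$ These weights sum to one and are, for every $n\ge0$, the weights of the BLUE when the noise has spectral density $f_\alpha$. The estimator $\widehat m_\alpha$ is asymptotically efficient for $f$: $$\frac{\operatorname{Var}_f(\widehat m_{BLU})}{\operatorname{Var}_f(\widehat m_{\alpha})}\longrightarrow 1\qquad(n\to\infty).$$ -/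

import Mathlib

open MeasureTheory Filter Topology Asymptotics

universe u v

noncomputable section

namespace MeanEstimation

/-- The covariance function `r(t) = ∫_{-π}^{π} e^{itx} f(x) dx` of a spectral density `f`. -/
def covFun (f : ℝ → ℝ) (t : ℤ) : ℂ :=
  ∫ x in (-Real.pi)..Real.pi, Complex.exp (Complex.I * (t : ℂ) * (x : ℂ)) * ((f x : ℝ) : ℂ)

/-- `Y` is a zero-mean, wide-sense stationary process (real- or complex-valued) with spectral
density `f` on `[-π, π]`. The map `RCLike.map 𝕜 ℂ` is the inclusion of `𝕜` (`ℝ` or `ℂ`) in `ℂ`. -/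
structure IsStationaryNoise {𝕜 : Type u} [RCLike 𝕜] {Ω : Type v} [MeasurableSpace Ω]
    (P : Measure Ω) (Y : ℤ → Ω → 𝕜) (f : ℝ → ℝ) : Prop where
  density_nonneg : ∀ᵐ x ∂(volume.restrict (Set.Icc (-Real.pi) Real.pi)), 0 ≤ f x
  density_integrable : IntegrableOn f (Set.Icc (-Real.pi) Real.pi)
  memLp : ∀ t, MemLp (Y t) 2 P
  mean_zero : ∀ t, ∫ ω, Y t ω ∂P = 0
  cov : ∀ s t : ℤ,
    RCLike.map 𝕜 ℂ (∫ ω, Y (t + s) ω * (starRingEnd 𝕜) (Y s ω) ∂P) = covFun f t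

/-- The linear estimator `∑_{k=0}^{n} c_k X(k)`. -/
def linEst {𝕜 : Type u} [RCLike 𝕜] {Ω : Type v} (X : ℤ → Ω → 𝕜) {n : ℕ}
    (c : Fin (n + 1) → 𝕜) (ω : Ω) : 𝕜 :=
  ∑ k : Fin (n + 1), c k * X ((k : ℕ) : ℤ) ω

/-- The variance `E|∑ c_k X(k) - m|²` of an unbiased linear estimator of the mean `m`. -/
def estVar {𝕜 : Type u} [RCLike 𝕜] {Ω : Type v} [MeasurableSpace Ω]
    (P : Measure Ω) (X : ℤ → Ω → 𝕜) (m : 𝕜) {n : ℕ} (c : Fin (n + 1) → 𝕜) : ℝ :=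
  ∫ ω, ‖linEst X c ω - m‖ ^ 2 ∂P

/-- `c` is a vector of weights of the best linear unbiased estimator of `m` based on
`X(0), …, X(n)`: it has minimal variance among all weights that sum to one. -/
def IsBLUE {𝕜 : Type u} [RCLike 𝕜] {Ω : Type v} [MeasurableSpace Ω]
    (P : Measure Ω) (X : ℤ → Ω → 𝕜) (m : 𝕜) {n : ℕ} (c : Fin (n + 1) → 𝕜) : Prop :=
  ∑ k, c k = 1 ∧
    ∀ d : Fin (n + 1) → 𝕜, ∑ k, d k = 1 → estVar P X m c ≤ estVar P X m d

/-- The class `B₀`: measurable, nonnegative and bounded on `[-π, π]`, continuous at `0`. -/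
structure MemB0 (h : ℝ → ℝ) : Prop where
  measurable : AEMeasurable h (volume.restrict (Set.Icc (-Real.pi) Real.pi))
  nonneg : ∀ x ∈ Set.Icc (-Real.pi) Real.pi, 0 ≤ h x
  bounded : ∃ C : ℝ, ∀ x ∈ Set.Icc (-Real.pi) Real.pi, h x ≤ C
  continuousAt : ContinuousAt h 0

/-- The class `B₀⁺`: members of `B₀` with a positive lower bound on `[-π, π]`. -/
structure MemB0Plus (h : ℝ → ℝ) : Prop extends MemB0 h where
  lower : ∃ δ : ℝ, 0 < δ ∧ ∀ x ∈ Set.Icc (-Real.pi) Real.pi, δ ≤ h x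

/-- The class `ZB₀⁺`: functions `h(x) ∏ |x - x_i|^{a_i}` on `[-π, π]` with `h ∈ B₀⁺`, finitely many
points `x_i ∈ [-π, π]` and exponents `a_i ≥ 0`. -/
def MemZB0Plus (g : ℝ → ℝ) : Prop :=
  ∃ h : ℝ → ℝ, MemB0Plus h ∧ ∃ (r : ℕ) (p a : Fin r → ℝ),
    (∀ i, p i ∈ Set.Icc (-Real.pi) Real.pi) ∧ (∀ i, 0 ≤ a i) ∧
    ∀ x ∈ Set.Icc (-Real.pi) Real.pi, g x = h x * ∏ i, |x - p i| ^ a i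

/-- `f_α(x) = (2π)⁻¹ |1 - e^{ix}|^{2α}`. -/
def fAlpha (α x : ℝ) : ℝ :=
  (2 * Real.pi)⁻¹ * ‖(1 : ℂ) - Complex.exp (Complex.I * (x : ℂ))‖ ^ (2 * α)

/-- The weights `c_k(n, α) = (n choose k) B(α+k+1, α+n-k+1) / B(α+1, α+1)`. -/
def alphaWeights (𝕜 : Type u) [RCLike 𝕜] (α : ℝ) (n : ℕ) (k : Fin (n + 1)) : 𝕜 :=
  (((n.choose (k : ℕ) : ℝ) *
    ProbabilityTheory.beta (α + (k : ℕ) + 1) (α + (n : ℝ) - (k : ℕ) + 1) /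
      ProbabilityTheory.beta (α + 1) (α + 1) : ℝ) : 𝕜)

end MeanEstimation

end

/-!
The variance of `∑ c_k X(k)` with `∑ c_k = 1` is the value of the quadratic form
`p ↦ ∫ |p(e^{ix})|² f(x) dx` (`spectralForm`) at the polynomial `p = ∑ c_k z ^ k`, so the BLUE
minimizes this form over the polynomials of degree at most `n` with `p(1) = 1`. The form is positive
definite, which makes the minimizer exist and be unique (`existsUnique_forall_re_dotProduct_le`).

*The density `f_α`.* Its Fourier coefficients satisfy `(t - α) r_t = (t + 1 + α) r_{t + 1}`
(`covFun_fAlpha_succ`, an integration by parts) and `r_0 = Γ(2α + 1) / Γ(α + 1)²` (a beta integral).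
The explicit weights satisfy a two-term recursion as well, and together the two recursions force
`∑ c_k r_{k - j}` to be the same for `j = 0, …, n` (`toeplitz_apply_eq_const`). These are the normal
equations, so the weights are optimal for `f_α`; by the Vandermonde identity the optimal variance is
`V_n = r_0 n! / (2α + 2)_n` (`blueVar`), and Euler's limit formula for `Γ` gives its rate.

*The density `f_α g`.* For the upper bound, multiplying the optimal polynomial for `f_α` by
`(1 + z) / 2` gives a competitor of degree `n + 1`, so that this polynomial has mass at most of the
order of `V_n - V_{n + 1} = o(V_n)` away from `0` (`spectralForm_alphaPoly_le`); only the value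
`g 0` matters in the limit. For the lower bound, every `B < g 0` is the value `|Q(1)|²` of a
polynomial `Q` with `|Q(e^{ix})|² ≤ g(x)` (`MemZB0Plus.exists_sharp_minorant`). If `p` is a
competitor of degree at most `n` then
`∫ |p|² f_α g ≥ ∫ |p Q|² f_α ≥ B V_{n + deg Q}`, and `V_{n + deg Q} / V_n` tends to `1`. Both the
optimal variance and the variance of the explicit estimator are therefore asymptotic to `g 0 * V_n`.
-/

noncomputable section

namespace MeanEstimation

/-! ### Rising factorials and the weights -/

/-- The Vandermonde identity for rising factorials. -/
theorem sum_choose_mul_ascPochhammer (x y : ℝ) (n : ℕ) :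
    ∑ k ∈ Finset.range (n + 1), (n.choose k : ℝ) * ((ascPochhammer ℝ k).eval x *
      (ascPochhammer ℝ (n - k)).eval y) = (ascPochhammer ℝ n).eval (x + y) := by
  rw [← Finset.Nat.sum_antidiagonal_eq_sum_range_succ
    (fun i j => (n.choose i : ℝ) * ((ascPochhammer ℝ i).eval x * (ascPochhammer ℝ j).eval y))]
  induction n with
  | zero => simp
  | succ n ih =>
    rw [Finset.sum_antidiagonal_choose_succ_mul
      (fun i j => (ascPochhammer ℝ i).eval x * (ascPochhammer ℝ j).eval y),
      ascPochhammer_succ_eval, ← ih, ← Finset.sum_add_distrib, Finset.sum_mul]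
    refine Finset.sum_congr rfl fun ij hij => ?_
    obtain ⟨i, j⟩ := ij
    have hn : i + j = n := by simpa using hij
    subst hn
    have hs : (i + j).choose j = (i + j).choose i := Nat.choose_symm_add.symm
    simp only [ascPochhammer_succ_eval, hs]
    push_cast
    ring

theorem Gamma_add_natCast {x : ℝ} (hx : 0 < x) (n : ℕ) :
    Real.Gamma (x + n) = (ascPochhammer ℝ n).eval x * Real.Gamma x := by
  induction n with
  | zero => simp
  | succ n ih =>
    rw [ascPochhammer_succ_eval, Nat.cast_succ, ← add_assoc, Real.Gamma_add_one (by positivity), ih]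
    ring

/-- The weights `c_k(n, α)`, written with rising factorials. -/
def weight (α : ℝ) (n k : ℕ) : ℝ :=
  (n.choose k : ℝ) * ((ascPochhammer ℝ k).eval (α + 1) * (ascPochhammer ℝ (n - k)).eval (α + 1)) /
    (ascPochhammer ℝ n).eval (2 * α + 2)

theorem alphaWeights_eq_weight (𝕜 : Type u) [RCLike 𝕜] {α : ℝ} (hα : -(1 / 2) < α) (n : ℕ)
    (k : Fin (n + 1)) : alphaWeights 𝕜 α n k = ((weight α n k : ℝ) : 𝕜) := by
  have hk : ((n - (k : ℕ) : ℕ) : ℝ) = (n : ℝ) - (k : ℕ) := Nat.cast_sub (by omega)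
  have h1 : 0 < α + 1 := by linarith
  have h2 : 0 < 2 * α + 2 := by linarith
  have e1 : α + ((k : ℕ) : ℝ) + 1 = (α + 1) + (k : ℕ) := by ring
  have e2 : α + (n : ℝ) - ((k : ℕ) : ℝ) + 1 = (α + 1) + ((n - (k : ℕ) : ℕ) : ℝ) := by
    rw [hk]; ring
  have e3 : (α + 1) + ((k : ℕ) : ℝ) + ((α + 1) + ((n - (k : ℕ) : ℕ) : ℝ)) = 2 * α + 2 + n := by
    rw [hk]; ring
  have e4 : α + 1 + (α + 1) = 2 * α + 2 := by ring
  rw [alphaWeights, weight]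
  congr 1
  rw [e1, e2]
  simp only [ProbabilityTheory.beta]
  rw [e3, e4, Gamma_add_natCast h1, Gamma_add_natCast h1, Gamma_add_natCast h2]
  have g1 := (Real.Gamma_pos_of_pos h1).ne'
  have g2 := (Real.Gamma_pos_of_pos h2).ne'
  have g3 := (ascPochhammer_pos n _ h2).ne'
  field_simp

theorem sum_weight {α : ℝ} (hα : -(1 / 2) < α) (n : ℕ) :
    ∑ k ∈ Finset.range (n + 1), weight α n k = 1 := by
  have h2 : 0 < 2 * α + 2 := by linarith
  simp only [weight]
  rw [← Finset.sum_div, sum_choose_mul_ascPochhammer, show α + 1 + (α + 1) = 2 * α + 2 by ring,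
    div_self (ascPochhammer_pos n _ h2).ne']

theorem weight_succ {α : ℝ} {n k : ℕ} (hk : k < n) :
    ((n : ℝ) - k) * (k + 1 + α) * weight α n k = (k + 1) * (n + α - k) * weight α n (k + 1) := by
  obtain ⟨m, rfl⟩ : ∃ m, n = k + 1 + m := ⟨n - k - 1, by omega⟩
  have e1 : k + 1 + m - k = m + 1 := by omega
  have e2 : k + 1 + m - (k + 1) = m := by omega
  have hc : (((k + 1 + m).choose (k + 1) : ℕ) : ℝ) * (k + 1) = 
      ((k + 1 + m).choose k : ℕ) * (m + 1) := by
    have := Nat.choose_succ_right_eq (k + 1 + m) k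
    rw [e1] at this
    exact_mod_cast this
  simp only [weight, e1, e2, ascPochhammer_succ_eval]
  push_cast
  generalize (((k + 1 + m).choose (k + 1) : ℕ) : ℝ) = A at *
  generalize (((k + 1 + m).choose k : ℕ) : ℝ) = B at *
  linear_combination (-(Polynomial.eval (α + 1) (ascPochhammer ℝ k)) *
    (Polynomial.eval (α + 1) (ascPochhammer ℝ m)) * (k + 1 + α) * (m + 1 + α) /
    (Polynomial.eval (2 * α + 2) (ascPochhammer ℝ (k + 1 + m)))) * hc

/-! ### The normal equations for the explicit weights -/

/-- A sequence `r` with the two-term recursion of the Fourier coefficients of `|1 - z|^{2α}` and a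
vector `c` with the two-term recursion of the weights are such that the Toeplitz matrix
`(r_{k - j})` maps `c` to a constant vector. The differences `Δ_j` of consecutive entries satisfy
`(n - j) (j + 1 + α) Δ_{j + 1} = j (n - j + 1 + α) Δ_j`, which is the hypergeometric differential
equation of `∑ c_k z ^ k` in disguise; at `j = 0` it gives `Δ_1 = 0`. -/
theorem toeplitz_apply_eq_const {α : ℝ} (hα : -(1 / 2) < α) {n : ℕ} {c : ℕ → ℂ} {r : ℤ → ℂ}
    (hr : ∀ t : ℤ, ((t : ℂ) - α) * r t = (t + 1 + α) * r (t + 1))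
    (hc : ∀ k < n, ((n : ℂ) - k) * (k + 1 + α) * c k = (k + 1) * (n + α - k) * c (k + 1))
    {j : ℕ} (hj : j ≤ n) :
    ∑ k ∈ Finset.range (n + 1), c k * r (k - j) = ∑ k ∈ Finset.range (n + 1), c k * r k := by
  set a : ℤ → ℂ := fun j => ∑ k ∈ Finset.range (n + 1), c k * r (k - j) with ha
  set b : ℤ → ℂ := fun j => ∑ k ∈ Finset.range (n + 1), k * c k * r (k - j) with hb
  -- the recursion of `r`, summed against `c`
  have h1 : ∀ j : ℤ, b j - b (j - 1) = (j + α) * a j - (j - 1 - α) * a (j - 1) := by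
    intro j
    simp only [ha, hb, Finset.mul_sum, ← Finset.sum_sub_distrib]
    refine Finset.sum_congr rfl fun k _ => ?_
    have := hr (k - j)
    rw [show (k : ℤ) - j + 1 = k - (j - 1) by ring] at this
    push_cast at this
    linear_combination (c k) * this
  -- the recursion of `c`, summed against `r`
  have hshift : ∀ j : ℤ,
      ∑ k ∈ Finset.range (n + 1), ((n : ℂ) - k) * (k + 1 + α) * c k * r (k - (j - 1))
      = ∑ k ∈ Finset.range (n + 1), (k : ℂ) * (n + α + 1 - k) * c k * r (k - j) := by
    intro j
    rw [Finset.sum_range_succ, Finset.sum_range_succ']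
    simp only [sub_self, zero_mul, add_zero, Nat.cast_zero]
    refine Finset.sum_congr rfl fun k hk => ?_
    rw [hc k (Finset.mem_range.mp hk)]
    push_cast
    rw [show (k : ℤ) - (j - 1) = k + 1 - j by ring]
    ring
  have h2 : ∀ j : ℤ, (j - n - 1) * b j - (j - n) * b (j - 1) + n * (α + 1) * a (j - 1) = 0 := by
    intro j
    have h := hshift j
    rw [← sub_eq_zero] at h
    rw [← h]
    simp only [ha, hb, Finset.mul_sum, ← Finset.sum_sub_distrib, ← Finset.sum_add_distrib]
    rw [← sub_eq_zero, ← Finset.sum_sub_distrib]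
    refine Finset.sum_eq_zero fun k _ => ?_
    have := hr (k - j)
    rw [show (k : ℤ) - j + 1 = k - (j - 1) by ring] at this
    push_cast at this
    linear_combination (-(k : ℂ) * c k) * this
  have h3 : ∀ j : ℤ, ((n : ℂ) - j) * (j + 1 + α) * (a (j + 1) - a j) =
      j * (n - j + 1 + α) * (a j - a (j - 1)) := by
    intro j
    have e1 := h1 j
    have e1' := h1 (j + 1)
    have e2 := h2 j
    have e2' := h2 (j + 1)
    rw [add_sub_cancel_right] at e1' e2'
    push_cast at e1' e2'
    linear_combination (-((n : ℂ) - j)) * e1' + ((n : ℂ) - j) * e1 - e2' + e2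
  have h4 : ∀ j : ℕ, j < n → a (j + 1) = a j := by
    intro j
    induction j with
    | zero =>
      intro hj
      have h := h3 0
      have hn : (n : ℂ) ≠ 0 := by exact_mod_cast hj.ne'
      have hα1 : (1 + α : ℂ) ≠ 0 := by
        have : (1 + α : ℝ) ≠ 0 := by linarith
        exact_mod_cast this
      simp only [Int.cast_zero, sub_zero, zero_add, zero_mul, mul_eq_zero, hn, hα1, false_or,
        or_false] at h
      simpa [sub_eq_zero] using h
    | succ j ih =>
      intro hj
      have h := h3 (j + 1)
      rw [add_sub_cancel_right, ih (by omega), sub_self, mul_zero] at h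
      have hn : (n : ℂ) - ((j + 1 : ℤ) : ℂ) ≠ 0 := by
        rw [sub_ne_zero]; push_cast; exact_mod_cast hj.ne'
      have hα1 : (((j + 1 : ℤ) : ℂ) + 1 + α : ℂ) ≠ 0 := by
        have : ((j : ℝ) + 1 + 1 + α : ℝ) ≠ 0 := by
          have : (0 : ℝ) ≤ j := by positivity
          linarith
        push_cast
        exact_mod_cast this
      simp only [mul_eq_zero, hn, hα1, false_or] at h
      push_cast
      rw [ih (by omega)]
      exact sub_eq_zero.mp h
  have h5 : ∀ j : ℕ, j ≤ n → a j = a 0 := by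
    intro j
    induction j with
    | zero => intro _; rfl
    | succ j ih =>
      intro hj
      rw [← ih (by omega), ← h4 j (by omega)]
      simp
  simpa [ha] using h5 j hj

/-- The value of the constant in `toeplitz_apply_eq_const`. -/
theorem sum_weight_mul {α : ℝ} (hα : -(1 / 2) < α) (n : ℕ) {r : ℤ → ℂ}
    (hr : ∀ t : ℤ, ((t : ℂ) - α) * r t = (t + 1 + α) * r (t + 1)) :
    ∑ k ∈ Finset.range (n + 1), (weight α n k : ℂ) * r k =
      ((n.factorial / (ascPochhammer ℝ n).eval (2 * α + 2) : ℝ) : ℂ) * r 0 := by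
  have h1 : 0 < α + 1 := by linarith
  have hrk : ∀ k : ℕ, (((ascPochhammer ℝ k).eval (α + 1) : ℝ) : ℂ) * r k =
      (((ascPochhammer ℝ k).eval (-α) : ℝ) : ℂ) * r 0 := by
    intro k
    induction k with
    | zero => simp
    | succ k ih =>
      have := hr k
      rw [ascPochhammer_succ_eval, ascPochhammer_succ_eval]
      push_cast at this ⊢
      linear_combination ((k : ℂ) - α) * ih -
        (((ascPochhammer ℝ k).eval (α + 1) : ℝ) : ℂ) * this
  have hV := sum_choose_mul_ascPochhammer (-α) (α + 1) n
  rw [show -α + (α + 1) = 1 by ring, ascPochhammer_eval_one] at hV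
  rw [← hV, Finset.sum_div, Complex.ofReal_sum, Finset.sum_mul]
  refine Finset.sum_congr rfl fun k _ => ?_
  rw [weight]
  push_cast
  linear_combination ((n.choose k : ℂ) * (((ascPochhammer ℝ (n - k)).eval (α + 1) : ℝ) : ℂ) /
    (((ascPochhammer ℝ n).eval (2 * α + 2) : ℝ) : ℂ)) * hrk k

/-! ### The optimal variance for `f_α` -/

/-- The minimal variance for the density `f_α` and sample size `n + 1`. -/
def blueVar (α : ℝ) (n : ℕ) : ℝ :=
  n.factorial / (ascPochhammer ℝ n).eval (2 * α + 2) *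
    (Real.Gamma (2 * α + 1) / Real.Gamma (α + 1) ^ 2)

theorem blueVar_pos {α : ℝ} (hα : -(1 / 2) < α) (n : ℕ) : 0 < blueVar α n := by
  have := ascPochhammer_pos n _ (show 0 < 2 * α + 2 by linarith)
  have := Real.Gamma_pos_of_pos (show 0 < 2 * α + 1 by linarith)
  have := Real.Gamma_pos_of_pos (show 0 < α + 1 by linarith)
  unfold blueVar
  positivity

theorem blueVar_succ {α : ℝ} (hα : -(1 / 2) < α) (n : ℕ) :
    blueVar α (n + 1) = blueVar α n * ((n + 1) / (n + (2 * α + 2))) := by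
  have h := ascPochhammer_pos n _ (show 0 < 2 * α + 2 by linarith)
  have h' : 0 < 2 * α + 2 + n := by
    have : (0 : ℝ) ≤ n := by positivity
    linarith
  rw [blueVar, blueVar, ascPochhammer_succ_eval, Nat.factorial_succ, add_comm (n : ℝ) (2 * α + 2)]
  push_cast
  field_simp

theorem tendsto_blueVar_succ_div {α : ℝ} (hα : -(1 / 2) < α) :
    Tendsto (fun n => blueVar α (n + 1) / blueVar α n) atTop (𝓝 1) := by
  have h : Tendsto (fun n : ℕ => ((n : ℝ) + 1) / (n + (2 * α + 2))) atTop (𝓝 1) := by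
    have := tendsto_add_mul_div_add_mul_atTop_nhds (𝕜 := ℝ) 1 (2 * α + 2) 1 (one_ne_zero)
    simpa [add_comm] using this
  refine h.congr fun n => ?_
  rw [blueVar_succ hα, mul_div_cancel_left₀ _ (blueVar_pos hα n).ne']

theorem tendsto_blueVar_add_div {α : ℝ} (hα : -(1 / 2) < α) (q : ℕ) :
    Tendsto (fun n => blueVar α (n + q) / blueVar α n) atTop (𝓝 1) := by
  induction q with
  | zero =>
    refine tendsto_const_nhds.congr fun n => ?_
    rw [add_zero, div_self (blueVar_pos hα n).ne']
  | succ q ih =>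
    have h := ((tendsto_blueVar_succ_div hα).comp (tendsto_add_atTop_nat q)).mul ih
    rw [one_mul] at h
    refine h.congr fun n => ?_
    have := (blueVar_pos hα (n + q)).ne'
    have := (blueVar_pos hα n).ne'
    simp only [Function.comp]
    rw [← add_assoc]
    field_simp

/-- Euler's limit formula for `Γ(2α + 2)` yields the rate of `blueVar`. -/
theorem blueVar_isEquivalent {α : ℝ} (hα : -(1 / 2) < α) :
    blueVar α ~[atTop] fun n : ℕ => (n : ℝ) ^ (-2 * α - 1) * Real.Gamma (2 * α + 1) /
      ProbabilityTheory.beta (α + 1) (α + 1) := by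
  have h2 : 0 < 2 * α + 2 := by linarith
  have g1 := (Real.Gamma_pos_of_pos (show 0 < 2 * α + 1 by linarith)).ne'
  have g2 := (Real.Gamma_pos_of_pos (show 0 < α + 1 by linarith)).ne'
  have g3 := (Real.Gamma_pos_of_pos h2).ne'
  have hG := Real.GammaSeq_tendsto_Gamma (2 * α + 2)
  have hq : Tendsto (fun n : ℕ => ((2 * α + 2) + n) / (n : ℝ)) atTop (𝓝 1) := by
    have := tendsto_add_mul_div_add_mul_atTop_nhds (𝕜 := ℝ) (2 * α + 2) 0 1 (one_ne_zero)
    simpa using this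
  have hlim := (hG.mul hq).div_const (Real.Gamma (2 * α + 2))
  rw [mul_one, div_self g3] at hlim
  refine isEquivalent_of_tendsto_one (hlim.congr' ?_)
  filter_upwards [eventually_gt_atTop 0] with n hn
  have hn' : (0 : ℝ) < n := by exact_mod_cast hn
  have hp := ascPochhammer_pos n _ h2
  have hprod : ∏ j ∈ Finset.range (n + 1), (2 * α + 2 + (j : ℝ)) =
      (ascPochhammer ℝ n).eval (2 * α + 2) * (2 * α + 2 + n) := by
    rw [← ascPochhammer_succ_eval]
    induction n + 1 with
    | zero => simp
    | succ m ih => rw [Finset.prod_range_succ, ih, ascPochhammer_succ_eval]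
  have hpow : (n : ℝ) ^ (2 * α + 2) * (n : ℝ) ^ (-2 * α - 1) = n := by
    rw [← Real.rpow_add hn']
    convert Real.rpow_one (n : ℝ) using 2
    ring
  have hpow' := Real.rpow_pos_of_pos hn' (-2 * α - 1)
  simp only [Pi.div_apply, Real.GammaSeq, hprod, blueVar, ProbabilityTheory.beta]
  rw [show α + 1 + (α + 1) = 2 * α + 2 by ring]
  have h3 : 0 < 2 * α + 2 + (n : ℝ) := by linarith
  have h3' := h3.ne'
  have hp' := hp.ne'
  generalize (n : ℝ) ^ (2 * α + 2) = A at *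
  generalize (n : ℝ) ^ (-2 * α - 1) = B at *
  generalize Real.Gamma (2 * α + 1) = G at *
  generalize 2 * α + 2 = s at *
  field_simp
  linear_combination hpow

/-! ### Fourier coefficients of the density `f_α` -/

theorem norm_one_sub_exp (x : ℝ) :
    ‖(1 : ℂ) - Complex.exp (Complex.I * x)‖ = 2 * |Real.sin (x / 2)| := by
  rw [norm_sub_rev, Complex.norm_exp_I_mul_ofReal_sub_one, norm_mul, Real.norm_eq_abs,
    Real.norm_eq_abs, abs_two]

theorem one_sub_exp_ne_zero {x : ℝ} (hx : x ∈ Set.Icc (-Real.pi) Real.pi) (h0 : x ≠ 0) :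
    (1 : ℂ) - Complex.exp (Complex.I * x) ≠ 0 := by
  have hpi := Real.pi_pos
  rw [← norm_ne_zero_iff, norm_one_sub_exp]
  have : Real.sin (x / 2) ≠ 0 := by
    rw [Ne, Real.sin_eq_zero_iff_of_lt_of_lt (by linarith [hx.1]) (by linarith [hx.2])]
    simpa using h0
  positivity

theorem fAlpha_nonneg (α x : ℝ) : 0 ≤ fAlpha α x := by
  unfold fAlpha
  positivity

theorem fAlpha_pos (α : ℝ) {x : ℝ} (hx : x ∈ Set.Icc (-Real.pi) Real.pi) (h0 : x ≠ 0) :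
    0 < fAlpha α x := by
  have := norm_pos_iff.mpr (one_sub_exp_ne_zero hx h0)
  have := Real.pi_pos
  unfold fAlpha
  positivity

theorem fAlpha_neg (α x : ℝ) : fAlpha α (-x) = fAlpha α x := by
  simp only [fAlpha, norm_one_sub_exp, neg_div, Real.sin_neg, abs_neg]

theorem image_one_sub_cos_div_two :
    (fun x : ℝ => (1 - Real.cos x) / 2) '' Set.Ioo 0 Real.pi = Set.Ioo 0 1 := by
  ext u
  constructor
  · rintro ⟨x, hx, rfl⟩
    have h1 : Real.cos x < 1 := by
      rw [← Real.cos_zero]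
      exact Real.cos_lt_cos_of_nonneg_of_le_pi le_rfl hx.2.le hx.1
    have h2 : -1 < Real.cos x := by
      rw [← Real.cos_pi]
      exact Real.cos_lt_cos_of_nonneg_of_le_pi hx.1.le le_rfl hx.2
    constructor <;> simp only <;> linarith
  · intro hu
    have hc : Real.cos (Real.arccos (1 - 2 * u)) = 1 - 2 * u :=
      Real.cos_arccos (by linarith [hu.2]) (by linarith [hu.1])
    refine ⟨Real.arccos (1 - 2 * u), ⟨Real.arccos_pos.mpr (by linarith [hu.1]), ?_⟩, ?_⟩
    · refine lt_of_le_of_ne (Real.arccos_le_pi _) fun h => ?_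
      rw [h, Real.cos_pi] at hc
      linarith [hu.2]
    · simp only [hc]
      ring

/-- Substituting `u = sin² (x / 2)` turns Euler's beta integral into an integral of `f_α`. -/
theorem integral_fAlpha_Ioo {α : ℝ} (hα : -(1 / 2) < α) :
    IntegrableOn (fAlpha α) (Set.Ioo 0 Real.pi) ∧
    ∫ x in Set.Ioo 0 Real.pi, fAlpha α x =
      (Real.Gamma (2 * α + 1) / Real.Gamma (α + 1) ^ 2) / 2 := by
  have hpi := Real.pi_pos
  set φ : ℝ → ℂ := fun u => (u : ℂ) ^ (((α + 1 / 2 : ℝ) : ℂ) - 1) *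
    (1 - (u : ℂ)) ^ (((1 / 2 : ℝ) : ℂ) - 1) with hφ
  have hder : ∀ x ∈ Set.Ioo 0 Real.pi, HasDerivWithinAt (fun x : ℝ => (1 - Real.cos x) / 2)
      (Real.sin x / 2) (Set.Ioo 0 Real.pi) x := by
    intro x _
    have := (((Real.hasDerivAt_cos x).const_sub 1).div_const 2).hasDerivWithinAt
      (s := Set.Ioo 0 Real.pi)
    simpa using this
  have hinj : Set.InjOn (fun x : ℝ => (1 - Real.cos x) / 2) (Set.Ioo 0 Real.pi) := by
    intro x hx y hy h
    refine Real.injOn_cos (Set.Ioo_subset_Icc_self hx) (Set.Ioo_subset_Icc_self hy) ?_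
    simp only at h
    linarith
  set K : ℝ := (2 * Real.pi)⁻¹ * 2 ^ (2 * α) with hK
  have hKpos : 0 < K := by positivity
  have hpt : ∀ x ∈ Set.Ioo 0 Real.pi, |Real.sin x / 2| • φ ((1 - Real.cos x) / 2) =
      ((K⁻¹ * fAlpha α x : ℝ) : ℂ) := by
    intro x hx
    have hs : 0 < Real.sin (x / 2) := Real.sin_pos_of_pos_of_lt_pi (by linarith [hx.1])
      (by linarith [hx.2])
    have hc : 0 < Real.cos (x / 2) := Real.cos_pos_of_mem_Ioo
      ⟨by linarith [hx.1], by linarith [hx.2]⟩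
    have h1 : Real.sin x = 2 * Real.sin (x / 2) * Real.cos (x / 2) := by
      rw [← Real.sin_two_mul, mul_div_cancel₀ _ (two_ne_zero)]
    have h2 : (1 - Real.cos x) / 2 = Real.sin (x / 2) ^ 2 := by
      have := Real.cos_two_mul (x / 2)
      have h := Real.sin_sq_add_cos_sq (x / 2)
      rw [mul_div_cancel₀ _ (two_ne_zero)] at this
      linarith
    have h3 : (1 : ℂ) - ((Real.sin (x / 2) ^ 2 : ℝ) : ℂ) = ((Real.cos (x / 2) ^ 2 : ℝ) : ℂ) := by
      rw [Real.cos_sq']; push_cast; ring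
    rw [h2, hφ]
    simp only
    rw [h3, ← Complex.ofReal_one, ← Complex.ofReal_sub, ← Complex.ofReal_sub,
      ← Complex.ofReal_cpow (by positivity), ← Complex.ofReal_cpow (by positivity),
      ← Complex.ofReal_mul, Complex.real_smul, ← Complex.ofReal_mul]
    congr 1
    rw [h1, fAlpha, norm_one_sub_exp, abs_of_pos hs, Real.mul_rpow (by norm_num) hs.le,
      abs_of_pos (by positivity), hK, ← Real.rpow_natCast (Real.sin (x / 2)),
      ← Real.rpow_natCast (Real.cos (x / 2)), ← Real.rpow_mul hs.le, ← Real.rpow_mul hc.le]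
    have e1 : Real.sin (x / 2) ^ (((2 : ℕ) : ℝ) * (α + 1 / 2 - 1)) * Real.sin (x / 2) =
        Real.sin (x / 2) ^ (2 * α) := by
      rw [← Real.rpow_add_one hs.ne']; congr 1; push_cast; ring
    have e2 : Real.cos (x / 2) ^ (((2 : ℕ) : ℝ) * (1 / 2 - 1)) * Real.cos (x / 2) = 1 := by
      rw [← Real.rpow_add_one hc.ne']; norm_num
    rw [← e1]
    generalize Real.cos (x / 2) ^ (((2 : ℕ) : ℝ) * (1 / 2 - 1)) = A at *
    generalize Real.sin (x / 2) ^ (((2 : ℕ) : ℝ) * (α + 1 / 2 - 1)) = B at *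
    have : (2 : ℝ) ^ (2 * α) ≠ 0 := by positivity
    field_simp
    linear_combination B * e2
  have hre1 : 0 < (((α + 1 / 2 : ℝ) : ℂ)).re := by rw [Complex.ofReal_re]; linarith
  have hre2 : 0 < (((1 / 2 : ℝ) : ℂ)).re := by rw [Complex.ofReal_re]; norm_num
  have hint : IntegrableOn φ (Set.Ioo 0 1) := by
    have := Complex.betaIntegral_convergent hre1 hre2
    rwa [intervalIntegrable_iff_integrableOn_Ioo_of_le zero_le_one] at this
  rw [← image_one_sub_cos_div_two, integrableOn_image_iff_integrableOn_abs_deriv_smul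
    measurableSet_Ioo hder hinj, integrableOn_congr_fun hpt measurableSet_Ioo] at hint
  have hint' : IntegrableOn (fAlpha α) (Set.Ioo 0 Real.pi) := by
    have := (hint.re).const_mul K
    refine this.congr (Eventually.of_forall fun x => ?_)
    simp only [RCLike.re_to_complex, Complex.ofReal_re]
    field_simp
  refine ⟨hint', ?_⟩
  have hval : ∫ u in Set.Ioo (0 : ℝ) 1, φ u =
      Complex.betaIntegral ((α + 1 / 2 : ℝ) : ℂ) ((1 / 2 : ℝ) : ℂ) := by
    rw [Complex.betaIntegral, intervalIntegral.integral_of_le zero_le_one,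
      integral_Ioc_eq_integral_Ioo]
  have hbeta := Complex.Gamma_mul_Gamma_eq_betaIntegral hre1 hre2
  rw [← hval, ← image_one_sub_cos_div_two, integral_image_eq_integral_abs_deriv_smul
    measurableSet_Ioo hder hinj, setIntegral_congr_fun measurableSet_Ioo hpt,
    integral_complex_ofReal, integral_const_mul, ← Complex.ofReal_add, Complex.Gamma_ofReal,
    Complex.Gamma_ofReal, Complex.Gamma_ofReal] at hbeta
  norm_cast at hbeta
  rw [show α + 1 / 2 + 1 / 2 = α + 1 by ring, Real.Gamma_one_half_eq] at hbeta
  -- the duplication formula removes `Γ(α + 1 / 2)`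
  have hdup := Real.Gamma_mul_Gamma_add_half (α + 1 / 2)
  rw [show α + 1 / 2 + 1 / 2 = α + 1 by ring, show 2 * (α + 1 / 2) = 2 * α + 1 by ring,
    show 1 - (2 * α + 1) = -(2 * α) by ring, Real.rpow_neg zero_le_two] at hdup
  have hG := (Real.Gamma_pos_of_pos (show 0 < α + 1 by linarith)).ne'
  have hsq := Real.mul_self_sqrt hpi.le
  have hsp : √Real.pi ≠ 0 := (Real.sqrt_pos.mpr hpi).ne'
  have h2 : (2 : ℝ) ^ (2 * α) ≠ 0 := by positivity
  rw [hK] at hbeta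
  generalize (∫ x in Set.Ioo 0 Real.pi, fAlpha α x) = J at *
  generalize Real.Gamma (α + 1) = G at *
  generalize Real.Gamma (2 * α + 1) = H at *
  generalize Real.Gamma (α + 1 / 2) = D at *
  generalize (2 : ℝ) ^ (2 * α) = T at *
  generalize √Real.pi = S at *
  rw [← hsq] at hbeta
  field_simp at hbeta hdup ⊢
  refine mul_right_cancel₀ hsp ?_
  linear_combination hdup - G * hbeta

theorem intervalIntegrable_fAlpha {α : ℝ} (hα : -(1 / 2) < α) :
    IntervalIntegrable (fAlpha α) volume (-Real.pi) Real.pi := by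
  have hpi := Real.pi_pos
  have h1 : IntervalIntegrable (fAlpha α) volume 0 Real.pi :=
    (intervalIntegrable_iff_integrableOn_Ioo_of_le hpi.le).mpr (integral_fAlpha_Ioo hα).1
  have h2 : IntervalIntegrable (fAlpha α) volume (-Real.pi) 0 := by
    have := (IntervalIntegrable.iff_comp_neg (f := fAlpha α)).mp h1
    simp only [fAlpha_neg, neg_zero] at this
    exact this.symm
  exact h2.trans h1

theorem integral_fAlpha {α : ℝ} (hα : -(1 / 2) < α) :
    ∫ x in (-Real.pi)..Real.pi, fAlpha α x =
      Real.Gamma (2 * α + 1) / Real.Gamma (α + 1) ^ 2 := by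
  have hpi := Real.pi_pos
  have h := intervalIntegrable_fAlpha hα
  have h1 : ∫ x in (0 : ℝ)..Real.pi, fAlpha α x =
      (Real.Gamma (2 * α + 1) / Real.Gamma (α + 1) ^ 2) / 2 := by
    rw [intervalIntegral.integral_of_le hpi.le, integral_Ioc_eq_integral_Ioo,
      (integral_fAlpha_Ioo hα).2]
  have h2 : ∫ x in (-Real.pi)..0, fAlpha α x = ∫ x in (0 : ℝ)..Real.pi, fAlpha α x := by
    have := intervalIntegral.integral_comp_neg (a := -Real.pi) (b := 0) (fAlpha α)
    simpa [fAlpha_neg] using this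
  have hmem : (0 : ℝ) ∈ Set.uIcc (-Real.pi) Real.pi := by
    rw [Set.uIcc_of_le (by linarith)]; constructor <;> linarith
  rw [← intervalIntegral.integral_add_adjacent_intervals
    (h.mono_set (Set.uIcc_subset_uIcc_left hmem)) (h.mono_set (Set.uIcc_subset_uIcc_right hmem)),
    h2, h1]
  ring

theorem covFun_fAlpha_zero {α : ℝ} (hα : -(1 / 2) < α) :
    covFun (fAlpha α) 0 = ((Real.Gamma (2 * α + 1) / Real.Gamma (α + 1) ^ 2 : ℝ) : ℂ) := by
  rw [← integral_fAlpha hα, ← intervalIntegral.integral_ofReal]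
  simp [covFun]

theorem norm_one_sub_exp_sq (x : ℝ) :
    ‖(1 : ℂ) - Complex.exp (Complex.I * x)‖ ^ 2 = 2 - 2 * Real.cos x := by
  have h := Real.cos_sq' (x / 2)
  have := Real.cos_sq (x / 2)
  rw [norm_one_sub_exp, mul_pow, sq_abs]
  rw [mul_div_cancel₀ _ (two_ne_zero)] at this
  linarith

theorem continuous_exp_I_mul : Continuous fun x : ℝ => Complex.exp (Complex.I * x) := by
  fun_prop

theorem intervalIntegrable_mul_density {f : ℝ → ℝ}
    (hf : IntervalIntegrable f volume (-Real.pi) Real.pi) {u : ℝ → ℂ} (hu : Continuous u) :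
    IntervalIntegrable (fun x => u x * (f x : ℂ)) volume (-Real.pi) Real.pi :=
  IntervalIntegrable.continuousOn_mul (f := fun x => (f x : ℂ)) ⟨hf.1.ofReal, hf.2.ofReal⟩
    hu.continuousOn

/-- The recursion of the Fourier coefficients of `f_α` follows by integrating the derivative of the
`2π`-periodic function `e^{itx} (1 - e^{ix}) |1 - e^{ix}|^{2α}`, which is continuous also at `0`
because `2 α + 1 > 0`. -/
theorem covFun_fAlpha_succ {α : ℝ} (hα : -(1 / 2) < α) (t : ℤ) :
    ((t : ℂ) - α) * covFun (fAlpha α) t = (t + 1 + α) * covFun (fAlpha α) (t + 1) := by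
  have hpi := Real.pi_pos
  set E : ℤ → ℝ → ℂ := fun t x => Complex.exp (Complex.I * (t : ℂ) * (x : ℂ)) with hE
  set z : ℝ → ℂ := fun x => Complex.exp (Complex.I * x) with hz
  have hEz : ∀ t x, E (t + 1) x = E t x * z x := by
    intro t x
    simp only [hE, hz, ← Complex.exp_add]
    congr 1
    push_cast
    ring
  have hEc : ∀ t, Continuous (E t) := fun t => by simp only [hE]; fun_prop
  have hzc : Continuous z := continuous_exp_I_mul
  have hEn : ∀ t x, ‖E t x‖ = 1 := by
    intro t x
    have : Complex.I * (t : ℂ) * (x : ℂ) = Complex.I * ((t * x : ℝ) : ℂ) := by push_cast; ring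
    simp only [hE, this, Complex.norm_exp_I_mul_ofReal]
  set F : ℝ → ℂ := fun x => E t x * (1 - z x) * ((‖1 - z x‖ ^ (2 * α) : ℝ) : ℂ) with hF
  set F' : ℝ → ℂ := fun x => (2 * Real.pi * Complex.I) * (((t : ℂ) - α) * (E t x * (fAlpha α x : ℂ))
    - (t + 1 + α) * (E (t + 1) x * (fAlpha α x : ℂ))) with hF'
  have hi : ∀ t, IntervalIntegrable (fun x => E t x * (fAlpha α x : ℂ)) volume (-Real.pi) Real.pi :=
    fun t => intervalIntegrable_mul_density (intervalIntegrable_fAlpha hα) (hEc t)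
  have hFnorm : ∀ x, ‖F x‖ = ‖1 - z x‖ ^ (2 * α + 1) := by
    intro x
    have h0 : 0 ≤ ‖1 - z x‖ := norm_nonneg _
    rw [hF]
    simp only [norm_mul, hEn, one_mul, Complex.norm_real, Real.norm_eq_abs]
    rw [abs_of_nonneg (Real.rpow_nonneg h0 _)]
    rcases h0.eq_or_lt with h | h
    · rw [← h, zero_mul, Real.zero_rpow (by linarith)]
    · rw [Real.rpow_add_one h.ne', mul_comm]
  have hcont : ContinuousOn F (Set.Icc (-Real.pi) Real.pi) := by
    intro x hx
    refine ContinuousAt.continuousWithinAt ?_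
    by_cases h0 : x = 0
    · subst h0
      have hF0 : F 0 = 0 := by simp [hF, hz]
      rw [ContinuousAt, hF0, tendsto_zero_iff_norm_tendsto_zero]
      have hc : Continuous fun x => ‖F x‖ := by
        simp only [hFnorm]
        exact (continuous_const.sub hzc).norm.rpow_const fun _ => Or.inr (by linarith)
      have := hc.tendsto 0
      rwa [hF0, norm_zero] at this
    · have hne : ‖1 - z x‖ ≠ 0 := norm_ne_zero_iff.mpr (one_sub_exp_ne_zero hx h0)
      have h1 : ContinuousAt (fun x => ‖1 - z x‖ ^ (2 * α)) x :=
        ((continuous_const.sub hzc).norm.continuousAt).rpow_const (Or.inl hne)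
      exact ((hEc t).mul (continuous_const.sub hzc)).continuousAt.mul
        (Complex.continuous_ofReal.continuousAt.comp h1)
  have hderiv : ∀ x ∈ Set.Ioo (-Real.pi) Real.pi \ {0}, HasDerivAt F (F' x) x := by
    intro x hx
    have hx0 : x ≠ 0 := hx.2
    have hpos : 0 < ‖1 - z x‖ :=
      norm_pos_iff.mpr (one_sub_exp_ne_zero (Set.Ioo_subset_Icc_self hx.1) hx0)
    have hsq := norm_one_sub_exp_sq x
    have hpos2 : 0 < 2 - 2 * Real.cos x := by rw [← hsq]; positivity
    have d1 : HasDerivAt (E t) (E t x * (Complex.I * t)) x := by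
      have := ((hasDerivAt_id (x : ℂ)).const_mul (Complex.I * (t : ℂ))).cexp.comp_ofReal
      simpa [hE] using this
    have d2 : HasDerivAt z (z x * Complex.I) x := by
      have := ((hasDerivAt_id (x : ℂ)).const_mul Complex.I).cexp.comp_ofReal
      simpa [hz] using this
    have d3 : HasDerivAt (fun x => ‖1 - z x‖ ^ (2 * α))
        (α * (2 * Real.sin x) / (2 - 2 * Real.cos x) * ‖1 - z x‖ ^ (2 * α)) x := by
      have e : ∀ y : ℝ, ‖1 - z y‖ ^ (2 * α) = (2 - 2 * Real.cos y) ^ α := by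
        intro y
        rw [← norm_one_sub_exp_sq y, ← Real.rpow_natCast, ← Real.rpow_mul (norm_nonneg _)]
        norm_num [hz]
      have h := (((Real.hasDerivAt_cos x).const_mul 2).const_sub 2).rpow_const (p := α)
        (Or.inl hpos2.ne')
      simp only [e]
      convert h using 1
      rw [Real.rpow_sub_one hpos2.ne']
      ring
    have d : HasDerivAt F _ x := (d1.mul (d2.const_sub 1)).mul d3.ofReal_comp
    refine d.congr_deriv (Eq.symm ?_)
    have hcs : z x = (Real.cos x : ℂ) + Complex.I * (Real.sin x : ℂ) := by
      simp only [hz]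
      rw [mul_comm, Complex.exp_mul_I, Complex.ofReal_cos, Complex.ofReal_sin]
      ring
    have hsc : ((Real.sin x : ℂ)) ^ 2 + (Real.cos x : ℂ) ^ 2 = 1 := by
      exact_mod_cast Real.sin_sq_add_cos_sq x
    have hne2 : (2 : ℂ) - 2 * (Real.cos x : ℂ) ≠ 0 := by exact_mod_cast hpos2.ne'
    -- `(1 - z) 2 sin x = -i (1 + z) |1 - z|²`
    have key : (1 - z x) * (α * (2 * (Real.sin x : ℂ)) / (2 - 2 * (Real.cos x : ℂ))) =
        -Complex.I * α * (1 + z x) := by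
      rw [hcs, mul_div_assoc', div_eq_iff hne2]
      linear_combination (-(2 * α * Complex.I)) * hsc +
        2 * α * (Real.sin x : ℂ) * (1 - (Real.cos x : ℂ)) * Complex.I_sq
    show 2 * Real.pi * Complex.I * (((t : ℂ) - α) * (E t x * (fAlpha α x : ℂ)) -
      (t + 1 + α) * (E (t + 1) x * (fAlpha α x : ℂ))) = _
    rw [hEz, fAlpha]
    simp only [Pi.mul_apply]
    have h2pi : (2 : ℂ) * (Real.pi : ℂ) * (2 * (Real.pi : ℂ))⁻¹ = 1 :=
      mul_inv_cancel₀ (by exact_mod_cast Real.two_pi_pos.ne')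
    have hzx : Complex.exp (Complex.I * (x : ℂ)) = z x := rfl
    rw [hzx]
    generalize ‖1 - z x‖ ^ (2 * α) = N
    push_cast at key ⊢
    linear_combination (Complex.I * N * E t x * ((t - α) - (t + 1 + α) * z x)) * h2pi -
      E t x * N * key
  have hint := integral_eq_of_hasDerivAt_off_countable_of_le F F' (by linarith)
    (Set.countable_singleton 0) hcont hderiv
    ((((hi t).const_mul _).sub ((hi (t + 1)).const_mul _)).const_mul _)
  have hper : F Real.pi = F (-Real.pi) := by
    have h1 : z Real.pi = z (-Real.pi) := by
      simp only [hz]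
      rw [Complex.exp_eq_exp_iff_exists_int]
      exact ⟨1, by push_cast; ring⟩
    have h2 : E t Real.pi = E t (-Real.pi) := by
      simp only [hE]
      rw [Complex.exp_eq_exp_iff_exists_int]
      exact ⟨t, by push_cast; ring⟩
    simp only [hF, h1, h2]
  rw [hper, sub_self, hF', intervalIntegral.integral_const_mul,
    intervalIntegral.integral_sub ((hi t).const_mul _) ((hi (t + 1)).const_mul _),
    intervalIntegral.integral_const_mul, intervalIntegral.integral_const_mul] at hint
  have hne : (2 * Real.pi * Complex.I : ℂ) ≠ 0 := Complex.two_pi_I_ne_zero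
  have := (mul_eq_zero.mp hint).resolve_left hne
  rw [sub_eq_zero] at this
  simpa [covFun, hE] using this

/-! ### The quadratic form of a spectral density on polynomials -/

/-- The quadratic form `∫ |p(e^{ix})|² f(x) dx` of a spectral density `f` on polynomials; it is the
variance of `∑ p_k Y(k)` for noise `Y` with density `f`. -/
def spectralForm (f : ℝ → ℝ) (p : Polynomial ℂ) : ℝ :=
  ∫ x in (-Real.pi)..Real.pi, ‖p.eval (Complex.exp (Complex.I * x))‖ ^ 2 * f x

theorem continuous_eval_exp (p : Polynomial ℂ) :
    Continuous fun x : ℝ => p.eval (Complex.exp (Complex.I * x)) :=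
  p.continuous.comp continuous_exp_I_mul

theorem intervalIntegrable_spectralForm {f : ℝ → ℝ}
    (hf : IntervalIntegrable f volume (-Real.pi) Real.pi) (p : Polynomial ℂ) :
    IntervalIntegrable (fun x : ℝ => ‖p.eval (Complex.exp (Complex.I * x))‖ ^ 2 * f x)
      volume (-Real.pi) Real.pi :=
  hf.continuousOn_mul ((continuous_eval_exp p).norm.pow 2).continuousOn

/-- The sesquilinear form of a spectral density, in terms of the covariance function. -/
theorem integral_eval_mul_conj_eval {f : ℝ → ℝ}
    (hf : IntervalIntegrable f volume (-Real.pi) Real.pi) {n : ℕ} {p q : Polynomial ℂ}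
    (hp : p.natDegree ≤ n) (hq : q.natDegree ≤ n) :
    ∫ x in (-Real.pi)..Real.pi, p.eval (Complex.exp (Complex.I * x)) *
        (starRingEnd ℂ) (q.eval (Complex.exp (Complex.I * x))) * (f x : ℂ) =
      ∑ j ∈ Finset.range (n + 1), ∑ k ∈ Finset.range (n + 1),
        p.coeff k * (starRingEnd ℂ) (q.coeff j) * covFun f (k - j) := by
  have hpt : ∀ x : ℝ, p.eval (Complex.exp (Complex.I * x)) *
      (starRingEnd ℂ) (q.eval (Complex.exp (Complex.I * x))) * (f x : ℂ) =
      ∑ j ∈ Finset.range (n + 1), ∑ k ∈ Finset.range (n + 1),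
        p.coeff k * (starRingEnd ℂ) (q.coeff j) *
          (Complex.exp (Complex.I * (((k : ℤ) - (j : ℤ) : ℤ) : ℂ) * (x : ℂ)) * (f x : ℂ)) := by
    intro x
    rw [Polynomial.eval_eq_sum_range' (Nat.lt_succ_of_le hp),
      Polynomial.eval_eq_sum_range' (Nat.lt_succ_of_le hq), map_sum, Finset.sum_mul_sum,
      Finset.sum_comm, Finset.sum_mul]
    refine Finset.sum_congr rfl fun j _ => ?_
    rw [Finset.sum_mul]
    refine Finset.sum_congr rfl fun k _ => ?_
    have e : Complex.exp (Complex.I * (((k : ℤ) - (j : ℤ) : ℤ) : ℂ) * (x : ℂ)) =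
        Complex.exp (Complex.I * x) ^ k * (starRingEnd ℂ) (Complex.exp (Complex.I * x) ^ j) := by
      rw [map_pow, ← Complex.exp_conj, ← Complex.exp_nat_mul, ← Complex.exp_nat_mul,
        ← Complex.exp_add]
      congr 1
      simp only [map_mul, Complex.conj_I, Complex.conj_ofReal]
      push_cast
      ring
    rw [e, map_mul]
    ring
  have hi : ∀ j k : ℕ, IntervalIntegrable (fun x : ℝ => p.coeff k * (starRingEnd ℂ) (q.coeff j) *
      (Complex.exp (Complex.I * (((k : ℤ) - (j : ℤ) : ℤ) : ℂ) * (x : ℂ)) * (f x : ℂ)))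
      volume (-Real.pi) Real.pi := fun j k =>
    (intervalIntegrable_mul_density hf (by fun_prop)).const_mul _
  simp only [hpt]
  rw [intervalIntegral.integral_finsetSum]
  · refine Finset.sum_congr rfl fun j _ => ?_
    rw [intervalIntegral.integral_finsetSum]
    · refine Finset.sum_congr rfl fun k _ => ?_
      rw [intervalIntegral.integral_const_mul, covFun]
    · exact fun k _ => hi j k
  · intro j _
    have := IntervalIntegrable.sum (Finset.range (n + 1)) (fun k _ => hi j k)
    simpa [Finset.sum_fn] using this

theorem ofReal_spectralForm (f : ℝ → ℝ) (p : Polynomial ℂ) :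
    (spectralForm f p : ℂ) = ∫ x in (-Real.pi)..Real.pi, p.eval (Complex.exp (Complex.I * x)) *
        (starRingEnd ℂ) (p.eval (Complex.exp (Complex.I * x))) * (f x : ℂ) := by
  rw [spectralForm, ← intervalIntegral.integral_ofReal]
  refine intervalIntegral.integral_congr fun x _ => ?_
  simp only [Complex.mul_conj, Complex.normSq_eq_norm_sq]
  push_cast
  ring

/-- The polynomial `∑ c_k(n, α) z ^ k` of the explicit weights. -/
def alphaPoly (α : ℝ) (n : ℕ) : Polynomial ℂ :=
  ∑ k ∈ Finset.range (n + 1), Polynomial.monomial k (weight α n k : ℂ)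

theorem natDegree_alphaPoly_le (α : ℝ) (n : ℕ) : (alphaPoly α n).natDegree ≤ n :=
  Polynomial.natDegree_sum_le_of_forall_le _ _ fun _ hk =>
    (Polynomial.natDegree_monomial_le _).trans (Nat.lt_succ_iff.mp (Finset.mem_range.mp hk))

theorem coeff_alphaPoly (α : ℝ) {n k : ℕ} (hk : k ∈ Finset.range (n + 1)) :
    (alphaPoly α n).coeff k = (weight α n k : ℂ) := by
  rw [alphaPoly, Polynomial.finsetSum_coeff, Finset.sum_eq_single_of_mem k hk,
    Polynomial.coeff_monomial_same]
  exact fun b _ hb => Polynomial.coeff_monomial_of_ne _ hb.symm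

theorem eval_one_alphaPoly {α : ℝ} (hα : -(1 / 2) < α) (n : ℕ) : (alphaPoly α n).eval 1 = 1 := by
  rw [alphaPoly, Polynomial.eval_finsetSum]
  simp only [Polynomial.eval_monomial, one_pow, mul_one]
  exact_mod_cast sum_weight hα n

/-- For the density `f_α`, the polynomial of the explicit weights represents evaluation at `1` on
polynomials of degree at most `n`, up to the factor `blueVar α n`. -/
theorem integral_alphaPoly_mul_conj {α : ℝ} (hα : -(1 / 2) < α) {n : ℕ} {q : Polynomial ℂ}
    (hq : q.natDegree ≤ n) :
    ∫ x in (-Real.pi)..Real.pi, (alphaPoly α n).eval (Complex.exp (Complex.I * x)) *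
        (starRingEnd ℂ) (q.eval (Complex.exp (Complex.I * x))) * (fAlpha α x : ℂ) =
      (blueVar α n : ℂ) * (starRingEnd ℂ) (q.eval 1) := by
  have hr := covFun_fAlpha_succ hα
  have hj : ∀ j ≤ n, ∑ k ∈ Finset.range (n + 1), (weight α n k : ℂ) *
      covFun (fAlpha α) (k - j) = blueVar α n := by
    intro j hj
    rw [toeplitz_apply_eq_const hα (c := fun k => (weight α n k : ℂ)) hr _ hj,
      sum_weight_mul hα n hr, covFun_fAlpha_zero hα, blueVar]
    · push_cast; ring
    · intro k hk
      exact_mod_cast weight_succ (α := α) hk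
  rw [integral_eval_mul_conj_eval (intervalIntegrable_fAlpha hα) (natDegree_alphaPoly_le α n) hq,
    Polynomial.eval_eq_sum_range' (Nat.lt_succ_of_le hq), map_sum, Finset.mul_sum]
  refine Finset.sum_congr rfl fun j hjr => ?_
  rw [one_pow, mul_one, ← hj j (Nat.lt_succ_iff.mp (Finset.mem_range.mp hjr)), Finset.sum_mul]
  refine Finset.sum_congr rfl fun k hk => ?_
  rw [coeff_alphaPoly α hk]
  ring

theorem spectralForm_alphaPoly {α : ℝ} (hα : -(1 / 2) < α) (n : ℕ) :
    spectralForm (fAlpha α) (alphaPoly α n) = blueVar α n := by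
  have h := integral_alphaPoly_mul_conj hα (natDegree_alphaPoly_le α n)
  rw [← ofReal_spectralForm, eval_one_alphaPoly hα, map_one, mul_one] at h
  exact_mod_cast h

/-- The explicit weights are optimal for the density `f_α`, in homogeneous form. -/
theorem blueVar_mul_le_spectralForm {α : ℝ} (hα : -(1 / 2) < α) {n : ℕ} {p : Polynomial ℂ}
    (hp : p.natDegree ≤ n) : blueVar α n * ‖p.eval 1‖ ^ 2 ≤ spectralForm (fAlpha α) p := by
  have hf := intervalIntegrable_fAlpha hα
  set a := p.eval 1 with ha
  set Q : ℝ → ℂ := fun x => (alphaPoly α n).eval (Complex.exp (Complex.I * x)) *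
        (starRingEnd ℂ) (p.eval (Complex.exp (Complex.I * x))) * (fAlpha α x : ℂ) with hQ
  have hQi : IntervalIntegrable Q volume (-Real.pi) Real.pi :=
    intervalIntegrable_mul_density hf
      ((continuous_eval_exp _).mul (Complex.continuous_conj.comp (continuous_eval_exp p)))
  have hre : ∫ x in (-Real.pi)..Real.pi, (a * Q x).re = blueVar α n * ‖a‖ ^ 2 := by
    have h := Complex.reCLM.intervalIntegral_comp_comm (hQi.const_mul a)
    simp only [Complex.reCLM_apply] at h
    rw [h, intervalIntegral.integral_const_mul, hQ, integral_alphaPoly_mul_conj hα hp, ← ha,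
      mul_left_comm, Complex.mul_conj, Complex.normSq_eq_norm_sq, ← Complex.ofReal_mul,
      Complex.ofReal_re]
  have hrei : IntervalIntegrable (fun x => (a * Q x).re) volume (-Real.pi) Real.pi :=
    ⟨(hQi.const_mul a).1.re, (hQi.const_mul a).2.re⟩
  have hci := intervalIntegrable_spectralForm hf (alphaPoly α n)
  have hmono := intervalIntegral.integral_mono_on (a := -Real.pi) (b := Real.pi)
    (by linarith [Real.pi_pos]) ((hrei.const_mul 2).sub (hci.const_mul (‖a‖ ^ 2)))
    (intervalIntegrable_spectralForm hf p) (fun x _ => by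
      have hf0 := fAlpha_nonneg α x
      set b := a * (alphaPoly α n).eval (Complex.exp (Complex.I * x)) with hb
      set c := p.eval (Complex.exp (Complex.I * x)) with hc
      have e1 : (a * Q x).re = (b * (starRingEnd ℂ) c).re * fAlpha α x := by
        rw [hQ, hb, ← Complex.re_mul_ofReal]
        congr 1
        ring
      have e2 : ‖a‖ ^ 2 * (‖(alphaPoly α n).eval (Complex.exp (Complex.I * x))‖ ^ 2 * fAlpha α x) =
          ‖b‖ ^ 2 * fAlpha α x := by
        rw [hb, norm_mul]; ring
      -- `0 ≤ |b - c|²`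
      have h : ‖b - c‖ ^ 2 = ‖b‖ ^ 2 + ‖c‖ ^ 2 - 2 * (b * (starRingEnd ℂ) c).re := by
        simp only [Complex.sq_norm, Complex.normSq_sub]
      have h0 := sq_nonneg ‖b - c‖
      show 2 * (a * Q x).re - ‖a‖ ^ 2 * _ ≤ ‖c‖ ^ 2 * fAlpha α x
      rw [e1, e2, ← sub_nonneg, show ‖c‖ ^ 2 * fAlpha α x - (2 * ((b * (starRingEnd ℂ) c).re *
        fAlpha α x) - ‖b‖ ^ 2 * fAlpha α x) = (‖b‖ ^ 2 + ‖c‖ ^ 2 -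
        2 * (b * (starRingEnd ℂ) c).re) * fAlpha α x by ring, ← h]
      positivity)
  rw [intervalIntegral.integral_sub (hrei.const_mul 2) (hci.const_mul (‖a‖ ^ 2)),
    intervalIntegral.integral_const_mul, intervalIntegral.integral_const_mul, hre] at hmono
  change 2 * (blueVar α n * ‖a‖ ^ 2) - ‖a‖ ^ 2 * spectralForm (fAlpha α) (alphaPoly α n) ≤
    spectralForm (fAlpha α) p at hmono
  rw [spectralForm_alphaPoly hα] at hmono
  linarith

/-- The form of `f_α` is positive definite, since a nonzero polynomial vanishes at only finitely
many points of the circle. -/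
theorem spectralForm_fAlpha_pos {α : ℝ} (hα : -(1 / 2) < α) {p : Polynomial ℂ} (hp : p ≠ 0) :
    0 < spectralForm (fAlpha α) p := by
  have hpi := Real.pi_pos
  rw [spectralForm, intervalIntegral.integral_pos_iff_support_of_nonneg_ae
    (Eventually.of_forall fun x => mul_nonneg (sq_nonneg _) (fAlpha_nonneg α x))
    (intervalIntegrable_spectralForm (intervalIntegrable_fAlpha hα) p)]
  refine ⟨by linarith, ?_⟩
  set Z : Set ℝ := {x ∈ Set.Ioc (-Real.pi) Real.pi | p.eval (Complex.exp (Complex.I * x)) = 0}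
    with hZ
  have hZfin : Z.Finite := by
    refine Set.Finite.of_injOn (f := fun x : ℝ => Complex.exp (Complex.I * x))
      (t := {z | p.IsRoot z}) (fun x hx => hx.2) ?_ (Polynomial.finite_setOfPred_isRoot hp)
    intro x hx y hy h
    have := Complex.exp_inj_of_neg_pi_lt_of_le_pi (x := Complex.I * x) (y := Complex.I * y)
      (by simpa using hx.1.1) (by simpa using hx.1.2) (by simpa using hy.1.1)
      (by simpa using hy.1.2) h
    exact_mod_cast mul_left_cancel₀ Complex.I_ne_zero this
  have hnull : volume (Z ∪ {0}) = 0 := (hZfin.union (Set.finite_singleton 0)).measure_zero _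
  have hsub : Set.Ioc (-Real.pi) Real.pi \ (Z ∪ {0}) ⊆ Function.support (fun x : ℝ =>
      ‖p.eval (Complex.exp (Complex.I * x))‖ ^ 2 * fAlpha α x) ∩ Set.Ioc (-Real.pi) Real.pi := by
    rintro x ⟨hx, hx'⟩
    simp only [Set.mem_union, Set.mem_singleton_iff, not_or] at hx'
    have h1 : p.eval (Complex.exp (Complex.I * x)) ≠ 0 := fun h => hx'.1 ⟨hx, h⟩
    have h2 := fAlpha_pos α (Set.Ioc_subset_Icc_self hx) hx'.2
    refine ⟨?_, hx⟩
    rw [Function.mem_support]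
    have := norm_pos_iff.mpr h1
    positivity
  refine lt_of_lt_of_le ?_ (measure_mono hsub)
  rw [measure_sdiff_null hnull, Real.volume_Ioc]
  simpa using hpi

/-- A minorant `|Q(e^{ix})|²` of `g` gives lower bounds for the form of `f_α g`. -/
theorem spectralForm_mul_le {α : ℝ} (hα : -(1 / 2) < α) {g : ℝ → ℝ}
    (hf : IntervalIntegrable (fun x => fAlpha α x * g x) volume (-Real.pi) Real.pi)
    {Q : Polynomial ℂ} (hQ : ∀ x ∈ Set.Icc (-Real.pi) Real.pi,
      ‖Q.eval (Complex.exp (Complex.I * x))‖ ^ 2 ≤ g x) (p : Polynomial ℂ) :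
    spectralForm (fAlpha α) (p * Q) ≤ spectralForm (fun x => fAlpha α x * g x) p := by
  refine intervalIntegral.integral_mono_on (by linarith [Real.pi_pos])
    (intervalIntegrable_spectralForm (intervalIntegrable_fAlpha hα) _)
    (intervalIntegrable_spectralForm hf p) fun x hx => ?_
  rw [Polynomial.eval_mul, norm_mul, mul_pow, mul_assoc, mul_comm (‖Polynomial.eval _ Q‖ ^ 2)]
  exact mul_le_mul_of_nonneg_left (mul_le_mul_of_nonneg_left (hQ x hx) (fAlpha_nonneg α x))
    (sq_nonneg _)

theorem norm_eval_half_one_add_X_sq (x : ℝ) :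
    ‖(Polynomial.C (1 / 2 : ℂ) * (1 + Polynomial.X)).eval (Complex.exp (Complex.I * x))‖ ^ 2 =
      (1 + Real.cos x) / 2 := by
  have h : (Polynomial.C (1 / 2 : ℂ) * (1 + Polynomial.X)).eval (Complex.exp (Complex.I * x)) =
      ((1 + Real.cos x) / 2 : ℝ) + ((Real.sin x) / 2 : ℝ) * Complex.I := by
    simp only [Polynomial.eval_mul, Polynomial.eval_C, Polynomial.eval_add, Polynomial.eval_one,
      Polynomial.eval_X]
    rw [mul_comm Complex.I, Complex.exp_mul_I]
    push_cast
    ring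
  rw [h, Complex.sq_norm, Complex.normSq_add_mul_I]
  linear_combination (Real.sin_sq_add_cos_sq x) / 4

/-- The mass that the optimal polynomial puts away from `0` is at most of the order of
`blueVar α n - blueVar α (n + 1)`: multiplying it by `(1 + z) / 2` yields a competitor of degree
`n + 1`. -/
theorem spectralForm_alphaPoly_le {α : ℝ} (hα : -(1 / 2) < α) {g : ℝ → ℝ}
    (hf : IntervalIntegrable (fun x => fAlpha α x * g x) volume (-Real.pi) Real.pi) {A K : ℝ}
    (hK : 0 ≤ K) (hg : ∀ x ∈ Set.Icc (-Real.pi) Real.pi,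
      g x ≤ A + K * (1 - (1 + Real.cos x) / 2)) (n : ℕ) :
    spectralForm (fun x => fAlpha α x * g x) (alphaPoly α n) ≤
      A * blueVar α n + K * (blueVar α n - blueVar α (n + 1)) := by
  set H : Polynomial ℂ := Polynomial.C (1 / 2 : ℂ) * (1 + Polynomial.X) with hH
  have hi := intervalIntegrable_spectralForm (intervalIntegrable_fAlpha hα) (alphaPoly α n)
  have hi' := intervalIntegrable_spectralForm (intervalIntegrable_fAlpha hα) (alphaPoly α n * H)
  have h1 : spectralForm (fun x => fAlpha α x * g x) (alphaPoly α n) ≤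
      (A + K) * spectralForm (fAlpha α) (alphaPoly α n) -
        K * spectralForm (fAlpha α) (alphaPoly α n * H) := by
    simp only [spectralForm]
    rw [← intervalIntegral.integral_const_mul, ← intervalIntegral.integral_const_mul,
      ← intervalIntegral.integral_sub (hi.const_mul _) (hi'.const_mul _)]
    refine intervalIntegral.integral_mono_on (by linarith [Real.pi_pos])
      (intervalIntegrable_spectralForm hf _) ((hi.const_mul _).sub (hi'.const_mul _)) fun x hx => ?_
    rw [Polynomial.eval_mul, norm_mul, mul_pow, hH, norm_eval_half_one_add_X_sq]
    have h := mul_le_mul_of_nonneg_left (hg x hx) (mul_nonneg (sq_nonneg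
      ‖(alphaPoly α n).eval (Complex.exp (Complex.I * x))‖) (fAlpha_nonneg α x))
    linarith
  have hdeg : (alphaPoly α n * H).natDegree ≤ n + 1 := by
    refine Polynomial.natDegree_mul_le.trans (add_le_add (natDegree_alphaPoly_le α n) ?_)
    rw [hH]
    compute_degree
  have h2 := blueVar_mul_le_spectralForm hα hdeg
  have hH1 : H.eval 1 = 1 := by
    simp only [hH, Polynomial.eval_mul, Polynomial.eval_C, Polynomial.eval_add,
      Polynomial.eval_one, Polynomial.eval_X]
    norm_num
  rw [Polynomial.eval_mul, eval_one_alphaPoly hα, hH1, mul_one, norm_one, one_pow, mul_one] at h2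
  rw [spectralForm_alphaPoly hα] at h1
  linarith [mul_le_mul_of_nonneg_left h2 hK]

/-! ### Majorants and minorants of the factor `g` -/

theorem exists_half_one_add_cos_le {η : ℝ} (hη : 0 < η) : ∃ θ : ℝ, 0 ≤ θ ∧ θ < 1 ∧
    ∀ x ∈ Set.Icc (-Real.pi) Real.pi, η ≤ |x| → (1 + Real.cos x) / 2 ≤ θ := by
  have hpi := Real.pi_pos
  have hm : 0 < min η Real.pi := lt_min hη hpi
  refine ⟨(1 + Real.cos (min η Real.pi)) / 2, by linarith [Real.neg_one_le_cos (min η Real.pi)],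
    ?_, fun x hx hxη => ?_⟩
  · have := Real.cos_lt_cos_of_nonneg_of_le_pi le_rfl (min_le_right η Real.pi) hm
    rw [Real.cos_zero] at this
    linarith
  · have := Real.cos_le_cos_of_nonneg_of_le_pi hm.le (abs_le.mpr hx)
      ((min_le_left η Real.pi).trans hxη)
    rw [Real.cos_abs] at this
    linarith

theorem MemZB0Plus.continuousAt {g : ℝ → ℝ} (hg : MemZB0Plus g) : ContinuousAt g 0 := by
  have hpi := Real.pi_pos
  obtain ⟨h, hh, r, p, a, hp, ha, hgx⟩ := hg
  have hc : ContinuousAt (fun x => h x * ∏ i, |x - p i| ^ a i) 0 := by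
    refine hh.continuousAt.mul (Continuous.continuousAt ?_)
    exact continuous_finsetProd _ fun i _ =>
      ((continuous_id.sub continuous_const).abs).rpow_const fun _ => Or.inr (ha i)
  refine hc.congr ?_
  filter_upwards [Icc_mem_nhds (show -Real.pi < 0 by linarith) hpi] with x hx
  exact (hgx x hx).symm

theorem MemZB0Plus.exists_bound {g : ℝ → ℝ} (hg : MemZB0Plus g) :
    ∃ M : ℝ, 0 ≤ M ∧ ∀ x ∈ Set.Icc (-Real.pi) Real.pi, g x ≤ M := by
  obtain ⟨h, hh, r, p, a, hp, ha, hgx⟩ := hg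
  obtain ⟨C, hC⟩ := hh.bounded
  have hc : Continuous fun x : ℝ => ∏ i, |x - p i| ^ a i :=
    continuous_finsetProd _ fun i _ =>
      ((continuous_id.sub continuous_const).abs).rpow_const fun _ => Or.inr (ha i)
  obtain ⟨D, hD⟩ := isCompact_Icc.exists_bound_of_continuousOn (s := Set.Icc (-Real.pi) Real.pi)
    hc.continuousOn
  refine ⟨|C| * |D|, by positivity, fun x hx => ?_⟩
  rw [hgx x hx]
  have h0 : 0 ≤ ∏ i, |x - p i| ^ a i := Finset.prod_nonneg fun i _ => by positivity
  exact mul_le_mul ((hC x hx).trans (le_abs_self C))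
    (((le_abs_self _).trans (hD x hx)).trans (le_abs_self D)) h0 (abs_nonneg C)

theorem MemZB0Plus.exists_majorant {g : ℝ → ℝ} (hg : MemZB0Plus g) {A : ℝ} (hA : g 0 < A)
    (hA0 : 0 ≤ A) : ∃ K : ℝ, 0 ≤ K ∧ ∀ x ∈ Set.Icc (-Real.pi) Real.pi,
      g x ≤ A + K * (1 - (1 + Real.cos x) / 2) := by
  obtain ⟨M, hM0, hM⟩ := hg.exists_bound
  obtain ⟨η, hη, hnear⟩ := Metric.eventually_nhds_iff.mp (hg.continuousAt.eventually_lt_const hA)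
  obtain ⟨θ, _, hθ1, hθ⟩ := exists_half_one_add_cos_le hη
  have h1θ : 0 < 1 - θ := by linarith
  refine ⟨M / (1 - θ), by positivity, fun x hx => ?_⟩
  rcases lt_or_ge |x| η with h | h
  · have h1 := hnear (show dist x 0 < η by simpa using h)
    have h2 : 0 ≤ M / (1 - θ) * (1 - (1 + Real.cos x) / 2) :=
      mul_nonneg (by positivity) (by linarith [Real.cos_le_one x])
    linarith
  · have h1 : M / (1 - θ) * (1 - θ) ≤ M / (1 - θ) * (1 - (1 + Real.cos x) / 2) :=
      mul_le_mul_of_nonneg_left (by linarith [hθ x hx h]) (by positivity)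
    rw [div_mul_cancel₀ _ h1θ.ne'] at h1
    linarith [hM x hx]

/-- Up to a constant, a zero `|x - p| ^ a` dominates the modulus of a polynomial with an even
larger zero at the same point. -/
theorem exists_poly_le_abs_sub_rpow {p a : ℝ} (hp : p ∈ Set.Icc (-Real.pi) Real.pi) (ha : 0 ≤ a)
    (h0 : p = 0 → a = 0) : ∃ (R : Polynomial ℂ) (κ : ℝ), R.eval 1 ≠ 0 ∧ 0 < κ ∧
      ∀ x ∈ Set.Icc (-Real.pi) Real.pi,
        κ * ‖R.eval (Complex.exp (Complex.I * x))‖ ^ 2 ≤ |x - p| ^ a := by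
  have hpi := Real.pi_pos
  by_cases ha0 : a = 0
  · exact ⟨1, 1, by simp, one_pos, fun x _ => by simp [ha0]⟩
  have hp0 : p ≠ 0 := fun h => ha0 (h0 h)
  set N := ⌈a⌉₊ with hN
  set M : ℝ := 2 * Real.pi + 1 with hM
  have hM1 : 1 ≤ M := by linarith
  have hM0 : 0 < M := by linarith
  refine ⟨(Polynomial.X - Polynomial.C (Complex.exp (Complex.I * p))) ^ N, (M ^ (2 * N))⁻¹,
    ?_, by positivity, fun x hx => ?_⟩
  · simp only [Polynomial.eval_pow, Polynomial.eval_sub, Polynomial.eval_X, Polynomial.eval_C]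
    exact pow_ne_zero _ (one_sub_exp_ne_zero hp hp0)
  · simp only [Polynomial.eval_pow, Polynomial.eval_sub, Polynomial.eval_X, Polynomial.eval_C]
    have hd : ‖Complex.exp (Complex.I * x) - Complex.exp (Complex.I * p)‖ ≤ |x - p| := by
      have e : Complex.exp (Complex.I * x) - Complex.exp (Complex.I * p) =
          Complex.exp (Complex.I * p) * (Complex.exp (Complex.I * ((x - p : ℝ) : ℂ)) - 1) := by
        rw [mul_sub, ← Complex.exp_add, mul_one]
        congr 2
        push_cast
        ring
      rw [e, norm_mul, Complex.norm_exp_I_mul_ofReal, one_mul, ← Real.norm_eq_abs]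
      exact Real.norm_exp_I_mul_ofReal_sub_one_le
    have hy : |x - p| ≤ M := by
      rw [abs_le]; constructor <;> linarith [hx.1, hx.2, hp.1, hp.2]
    set s := |x - p| / M with hs
    have hs0 : 0 ≤ s := by positivity
    have hs1 : s ≤ 1 := (div_le_one hM0).mpr hy
    have h1 : s ^ (2 * N) ≤ s ^ a := by
      rw [← Real.rpow_natCast]
      refine Real.rpow_le_rpow_of_exponent_ge' hs0 hs1 ha ?_
      have := Nat.le_ceil a
      push_cast
      linarith
    have h2 : s ^ a ≤ |x - p| ^ a :=
      Real.rpow_le_rpow hs0 (div_le_self (abs_nonneg _) hM1) ha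
    refine le_trans ?_ (h1.trans h2)
    rw [norm_pow, ← pow_mul, mul_comm N 2, hs, div_pow, div_eq_inv_mul]
    gcongr

theorem MemZB0Plus.exists_poly_minorant {g : ℝ → ℝ} (hg : MemZB0Plus g) (hg0 : 0 < g 0) :
    ∃ (R : Polynomial ℂ) (κ : ℝ), R.eval 1 ≠ 0 ∧ 0 < κ ∧
      ∀ x ∈ Set.Icc (-Real.pi) Real.pi,
        κ * ‖R.eval (Complex.exp (Complex.I * x))‖ ^ 2 ≤ g x := by
  have hpi := Real.pi_pos
  obtain ⟨h, hh, r, p, a, hp, ha, hgx⟩ := hg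
  obtain ⟨δ, hδ, hlow⟩ := hh.lower
  -- `0 ^ 0 = 1` in `ℝ`, so `g 0 > 0` still allows `p i = 0` with exponent `a i = 0`
  have hpa : ∀ i, p i = 0 → a i = 0 := by
    intro i hi
    by_contra hai
    rw [hgx 0 ⟨by linarith, hpi.le⟩, Finset.prod_eq_zero (Finset.mem_univ i), mul_zero] at hg0
    · exact lt_irrefl _ hg0
    · rw [hi, sub_zero, abs_zero, Real.zero_rpow hai]
  choose R κ hR hκ hRκ using fun i => exists_poly_le_abs_sub_rpow (hp i) (ha i) (hpa i)
  refine ⟨∏ i, R i, δ * ∏ i, κ i, ?_, mul_pos hδ (Finset.prod_pos fun i _ => hκ i),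
    fun x hx => ?_⟩
  · rw [Polynomial.eval_prod]
    exact Finset.prod_ne_zero_iff.mpr fun i _ => hR i
  · rw [Polynomial.eval_prod, norm_prod, ← Finset.prod_pow, mul_assoc, ← Finset.prod_mul_distrib,
      hgx x hx]
    refine mul_le_mul (hlow x hx) (Finset.prod_le_prod (fun i _ => ?_) fun i _ => hRκ i x hx)
      (Finset.prod_nonneg fun i _ => ?_) (hδ.le.trans (hlow x hx))
    · exact mul_nonneg (hκ i).le (sq_nonneg _)
    · exact mul_nonneg (hκ i).le (sq_nonneg _)

/-- A polynomial minorant of `g` that is almost sharp at `0`: the factor `((1 + z) / 2) ^ N` makes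
it small away from `0`, and the zeros of `R` take care of those of `g`. -/
theorem MemZB0Plus.exists_sharp_minorant {g : ℝ → ℝ} (hg : MemZB0Plus g) {B : ℝ} (hB : 0 < B)
    (hBg : B < g 0) : ∃ Q : Polynomial ℂ, ‖Q.eval 1‖ ^ 2 = B ∧
      ∀ x ∈ Set.Icc (-Real.pi) Real.pi, ‖Q.eval (Complex.exp (Complex.I * x))‖ ^ 2 ≤ g x := by
  obtain ⟨R, κ, hR, hκ, hRκ⟩ := hg.exists_poly_minorant (hB.trans hBg)
  have hR1 : 0 < ‖R.eval 1‖ ^ 2 := by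
    have := norm_pos_iff.mpr hR
    positivity
  set L : ℝ → ℝ := fun x => B / ‖R.eval 1‖ ^ 2 * ‖R.eval (Complex.exp (Complex.I * x))‖ ^ 2 with hL
  have hLc : Continuous L := continuous_const.mul ((continuous_eval_exp R).norm.pow 2)
  have hL0 : L 0 = B := by
    simp only [hL, Complex.ofReal_zero, mul_zero, Complex.exp_zero]
    rw [div_mul_cancel₀ _ hR1.ne']
  obtain ⟨η, hη, hnear⟩ := Metric.eventually_nhds_iff.mp
    (hLc.continuousAt.eventually_lt hg.continuousAt (by rwa [hL0]))
  obtain ⟨θ, hθ0, hθ1, hθ⟩ := exists_half_one_add_cos_le hη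
  obtain ⟨N, hN⟩ := exists_pow_lt_of_lt_one (show 0 < κ * ‖R.eval 1‖ ^ 2 / B by positivity) hθ1
  rw [lt_div_iff₀ hB] at hN
  set H : Polynomial ℂ := Polynomial.C (1 / 2 : ℂ) * (1 + Polynomial.X) with hH
  have hH1 : H.eval 1 = 1 := by
    simp only [hH, Polynomial.eval_mul, Polynomial.eval_C, Polynomial.eval_add,
      Polynomial.eval_one, Polynomial.eval_X]
    norm_num
  have hQ : ∀ z, ‖(Polynomial.C ((√(B / ‖R.eval 1‖ ^ 2) : ℝ) : ℂ) * R * H ^ N).eval z‖ ^ 2 =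
      B / ‖R.eval 1‖ ^ 2 * ‖R.eval z‖ ^ 2 * (‖H.eval z‖ ^ 2) ^ N := by
    intro z
    rw [Polynomial.eval_mul, Polynomial.eval_mul, Polynomial.eval_pow, Polynomial.eval_C, norm_mul,
      norm_mul, norm_pow, Complex.norm_real, mul_pow, mul_pow, Real.norm_eq_abs, sq_abs,
      Real.sq_sqrt (by positivity), pow_right_comm]
  refine ⟨Polynomial.C ((√(B / ‖R.eval 1‖ ^ 2) : ℝ) : ℂ) * R * H ^ N, ?_, fun x hx => ?_⟩
  · rw [hQ, hH1, norm_one, one_pow, one_pow, mul_one, div_mul_cancel₀ _ hR1.ne']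
  · rw [hQ, hH, norm_eval_half_one_add_X_sq]
    have hw0 : 0 ≤ (1 + Real.cos x) / 2 := by linarith [Real.neg_one_le_cos x]
    have hw1 : (1 + Real.cos x) / 2 ≤ 1 := by linarith [Real.cos_le_one x]
    have hLx : 0 ≤ B / ‖R.eval 1‖ ^ 2 * ‖R.eval (Complex.exp (Complex.I * x))‖ ^ 2 := by positivity
    rcases lt_or_ge |x| η with h | h
    · have h1 := hnear (show dist x 0 < η by simpa using h)
      exact (mul_le_of_le_one_right hLx (pow_le_one₀ hw0 hw1)).trans h1.le
    · have h1 : ((1 + Real.cos x) / 2) ^ N ≤ θ ^ N := pow_le_pow_left₀ hw0 (hθ x hx h) N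
      have h2 : B / ‖R.eval 1‖ ^ 2 * θ ^ N ≤ κ := by
        rw [div_mul_eq_mul_div, div_le_iff₀ hR1]
        linarith
      calc _ ≤ B / ‖R.eval 1‖ ^ 2 * ‖R.eval (Complex.exp (Complex.I * x))‖ ^ 2 * θ ^ N :=
            mul_le_mul_of_nonneg_left h1 hLx
        _ = B / ‖R.eval 1‖ ^ 2 * θ ^ N * ‖R.eval (Complex.exp (Complex.I * x))‖ ^ 2 := by ring
        _ ≤ κ * ‖R.eval (Complex.exp (Complex.I * x))‖ ^ 2 :=
            mul_le_mul_of_nonneg_right h2 (sq_nonneg _)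
        _ ≤ g x := hRκ x hx

/-! ### The inclusion of the scalars in `ℂ` -/

section RCLikeMap

variable {𝕜 : Type u} [RCLike 𝕜]

theorem map_complex_re (a : 𝕜) : (RCLike.map 𝕜 ℂ a).re = RCLike.re a := by simp

theorem map_complex_im (a : 𝕜) : (RCLike.map 𝕜 ℂ a).im = RCLike.im a := by simp

theorem map_complex_mul (a b : 𝕜) :
    RCLike.map 𝕜 ℂ (a * b) = RCLike.map 𝕜 ℂ a * RCLike.map 𝕜 ℂ b := by
  apply Complex.ext
  · simp only [Complex.mul_re, map_complex_re, map_complex_im, RCLike.mul_re]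
  · simp only [Complex.mul_im, map_complex_re, map_complex_im, RCLike.mul_im]

theorem map_complex_conj (a : 𝕜) :
    RCLike.map 𝕜 ℂ ((starRingEnd 𝕜) a) = (starRingEnd ℂ) (RCLike.map 𝕜 ℂ a) := by
  apply Complex.ext
  · simp only [Complex.conj_re, map_complex_re, RCLike.conj_re]
  · simp only [Complex.conj_im, map_complex_im, RCLike.conj_im]

theorem map_complex_ofReal (r : ℝ) : RCLike.map 𝕜 ℂ (r : 𝕜) = (r : ℂ) := by
  apply Complex.ext
  · simp only [map_complex_re, RCLike.ofReal_re, Complex.ofReal_re]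
  · simp only [map_complex_im, RCLike.ofReal_im, Complex.ofReal_im]

theorem map_complex_injective : Function.Injective (RCLike.map 𝕜 ℂ) := by
  intro a b h
  apply RCLike.ext
  · rw [← map_complex_re, h, map_complex_re]
  · rw [← map_complex_im, h, map_complex_im]

end RCLikeMap

/-! ### Minimizing a positive definite form over the weights that sum to one -/

open Matrix in
/-- The minimizer is the multiple of `G⁻¹ 1` whose entries sum to one. -/
theorem existsUnique_forall_re_dotProduct_le {𝕜 ι : Type*} [RCLike 𝕜] [Fintype ι] [Nonempty ι]
    {G : Matrix ι ι 𝕜} (hG : G.IsHermitian)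
    (hpos : ∀ x : ι → 𝕜, x ≠ 0 → 0 < RCLike.re (star x ⬝ᵥ G *ᵥ x)) :
    ∃! c : ι → 𝕜, ∑ k, c k = 1 ∧ ∀ d : ι → 𝕜, ∑ k, d k = 1 →
      RCLike.re (star c ⬝ᵥ G *ᵥ c) ≤ RCLike.re (star d ⬝ᵥ G *ᵥ d) := by
  classical
  have hinj : Function.Injective (Matrix.mulVecLin G) := by
    rw [injective_iff_map_eq_zero]
    intro x hx
    by_contra hne
    have := hpos x hne
    rw [Matrix.mulVecLin_apply] at hx
    rw [hx, dotProduct_zero, map_zero] at this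
    exact lt_irrefl _ this
  obtain ⟨w, hw⟩ := LinearMap.injective_iff_surjective.mp hinj (1 : ι → 𝕜)
  rw [Matrix.mulVecLin_apply] at hw
  have hw0 : w ≠ 0 := by
    rintro rfl
    rw [Matrix.mulVec_zero] at hw
    exact zero_ne_one hw
  have hs : ∑ k, w k ≠ 0 := by
    intro h
    have := hpos w hw0
    rw [hw, dotProduct_one] at this
    simp only [Pi.star_apply] at this
    rw [← star_sum, h, star_zero, map_zero] at this
    exact lt_irrefl _ this
  set c : ι → 𝕜 := (∑ k, w k)⁻¹ • w with hc
  have hc1 : ∑ k, c k = 1 := by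
    simp only [hc, Pi.smul_apply, smul_eq_mul, ← Finset.mul_sum]
    exact inv_mul_cancel₀ hs
  have hGc : G *ᵥ c = (∑ k, w k)⁻¹ • (1 : ι → 𝕜) := by rw [hc, Matrix.mulVec_smul, hw]
  -- Pythagoras: `G c` is a multiple of `1`, hence orthogonal to `d - c`
  have hsplit : ∀ d : ι → 𝕜, ∑ k, d k = 1 → RCLike.re (star d ⬝ᵥ G *ᵥ d) =
      RCLike.re (star c ⬝ᵥ G *ᵥ c) + RCLike.re (star (d - c) ⬝ᵥ G *ᵥ (d - c)) := by
    intro d hd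
    have he : ∑ k, (d - c) k = 0 := by
      simp only [Pi.sub_apply, Finset.sum_sub_distrib, hd, hc1, sub_self]
    have h1 : star (d - c) ⬝ᵥ G *ᵥ c = 0 := by
      rw [hGc, dotProduct_smul, dotProduct_one]
      simp only [Pi.star_apply]
      rw [← star_sum, he, star_zero, smul_zero]
    have h2 : star c ⬝ᵥ G *ᵥ (d - c) = 0 := by
      have := congrArg star h1
      rwa [star_zero, ← star_dotProduct_star, star_star, star_mulVec, hG.eq,
        ← dotProduct_mulVec] at this
    have hd' : d = c + (d - c) := by abel
    conv_lhs => rw [hd']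
    rw [Matrix.mulVec_add, star_add, add_dotProduct, dotProduct_add, dotProduct_add, h1, h2,
      add_zero, zero_add, map_add]
  refine ⟨c, ⟨hc1, fun d hd => ?_⟩, fun d ⟨hd, hmin⟩ => ?_⟩
  · rw [hsplit d hd, le_add_iff_nonneg_right]
    by_cases h : d - c = 0
    · rw [h, Matrix.mulVec_zero, dotProduct_zero, map_zero]
    · exact (hpos _ h).le
  · by_contra hne
    have h1 := hpos _ (sub_ne_zero.mpr hne)
    have h2 := hmin c hc1
    rw [hsplit d hd] at h2
    linarith

/-! ### Variances of linear unbiased estimators -/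

theorem linEst_sub_mean {𝕜 : Type u} [RCLike 𝕜] {Ω : Type v} {X Y : ℤ → Ω → 𝕜} {m : 𝕜}
    (hX : ∀ t ω, X t ω = m + Y t ω) {n : ℕ} {c : Fin (n + 1) → 𝕜} (hc : ∑ k, c k = 1) (ω : Ω) :
    linEst X c ω - m = ∑ k, c k * Y ((k : ℕ) : ℤ) ω := by
  simp only [linEst, hX, mul_add, Finset.sum_add_distrib]
  rw [← Finset.sum_mul, hc, one_mul, add_sub_cancel_left]

section Variance

variable {𝕜 : Type u} [RCLike 𝕜] {Ω : Type v} [MeasurableSpace Ω] {P : Measure Ω}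

/-- The polynomial `∑ c_k z ^ k` of a vector of weights, with coefficients in `ℂ`. -/
def weightPoly {n : ℕ} (c : Fin (n + 1) → 𝕜) : Polynomial ℂ :=
  ∑ k : Fin (n + 1), Polynomial.monomial (k : ℕ) (RCLike.map 𝕜 ℂ (c k))

theorem natDegree_weightPoly_le {n : ℕ} (c : Fin (n + 1) → 𝕜) : (weightPoly c).natDegree ≤ n :=
  Polynomial.natDegree_sum_le_of_forall_le _ _ fun k _ =>
    (Polynomial.natDegree_monomial_le _).trans (Nat.lt_succ_iff.mp k.2)

theorem coeff_weightPoly {n : ℕ} (c : Fin (n + 1) → 𝕜) (k : Fin (n + 1)) :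
    (weightPoly c).coeff k = RCLike.map 𝕜 ℂ (c k) := by
  rw [weightPoly, Polynomial.finsetSum_coeff, Finset.sum_eq_single_of_mem k (Finset.mem_univ k),
    Polynomial.coeff_monomial_same]
  exact fun b _ hb => Polynomial.coeff_monomial_of_ne _ fun h => hb (Fin.ext h.symm)

theorem eval_one_weightPoly {n : ℕ} {c : Fin (n + 1) → 𝕜} (hc : ∑ k, c k = 1) :
    (weightPoly c).eval 1 = 1 := by
  rw [weightPoly, Polynomial.eval_finsetSum]
  simp only [Polynomial.eval_monomial, one_pow, mul_one]
  rw [← map_sum, hc, ← RCLike.ofReal_one, map_complex_ofReal, Complex.ofReal_one]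

theorem weightPoly_ne_zero {n : ℕ} {c : Fin (n + 1) → 𝕜} (hc : c ≠ 0) : weightPoly c ≠ 0 := by
  obtain ⟨k, hk⟩ := Function.ne_iff.mp hc
  intro h
  have := coeff_weightPoly c k
  rw [h, Polynomial.coeff_zero, ← map_zero (RCLike.map 𝕜 ℂ)] at this
  exact hk (map_complex_injective this.symm)

theorem weightPoly_alphaWeights {α : ℝ} (hα : -(1 / 2) < α) (n : ℕ) :
    weightPoly (alphaWeights 𝕜 α n) = alphaPoly α n := by
  rw [weightPoly, alphaPoly, Finset.sum_range]
  refine Finset.sum_congr rfl fun k _ => ?_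
  rw [alphaWeights_eq_weight 𝕜 hα, map_complex_ofReal]

theorem sum_alphaWeights {α : ℝ} (hα : -(1 / 2) < α) (n : ℕ) :
    ∑ k, alphaWeights 𝕜 α n k = 1 := by
  simp only [alphaWeights_eq_weight 𝕜 hα]
  rw [← RCLike.ofReal_sum, ← Finset.sum_range (fun k => weight α n k), sum_weight hα,
    RCLike.ofReal_one]

/-- The covariance matrix of `Y(0), …, Y(n)`, transposed so that `star c ⬝ᵥ G *ᵥ c` is the variance
of `∑ c_k Y(k)`. -/
def gramMatrix (P : Measure Ω) (Y : ℤ → Ω → 𝕜) (n : ℕ) :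
    Matrix (Fin (n + 1)) (Fin (n + 1)) 𝕜 :=
  fun j k => ∫ ω, Y ((k : ℕ) : ℤ) ω * (starRingEnd 𝕜) (Y ((j : ℕ) : ℤ) ω) ∂P

theorem isHermitian_gramMatrix (P : Measure Ω) (Y : ℤ → Ω → 𝕜) (n : ℕ) :
    (gramMatrix P Y n).IsHermitian := by
  ext j k
  rw [Matrix.conjTranspose_apply, gramMatrix, gramMatrix, ← starRingEnd_apply, ← integral_conj]
  refine integral_congr_ae (Eventually.of_forall fun ω => ?_)
  simp only [map_mul, RCLike.conj_conj]
  ring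

open Matrix in
theorem star_dotProduct_gramMatrix_mulVec {Y : ℤ → Ω → 𝕜} (hY : ∀ t, MemLp (Y t) 2 P) {n : ℕ}
    (c : Fin (n + 1) → 𝕜) : star c ⬝ᵥ gramMatrix P Y n *ᵥ c =
      ((∫ ω, ‖∑ k, c k * Y ((k : ℕ) : ℤ) ω‖ ^ 2 ∂P : ℝ) : 𝕜) := by
  have hi : ∀ j k : Fin (n + 1), Integrable (fun ω => (starRingEnd 𝕜) (c j) * c k *
      (Y ((k : ℕ) : ℤ) ω * (starRingEnd 𝕜) (Y ((j : ℕ) : ℤ) ω))) P := fun j k =>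
    (MemLp.integrable_mul (hY _) (hY _).star).const_mul _
  have hpt : ∀ ω, ((‖∑ k, c k * Y ((k : ℕ) : ℤ) ω‖ ^ 2 : ℝ) : 𝕜) =
      ∑ j : Fin (n + 1), ∑ k : Fin (n + 1), (starRingEnd 𝕜) (c j) * c k *
        (Y ((k : ℕ) : ℤ) ω * (starRingEnd 𝕜) (Y ((j : ℕ) : ℤ) ω)) := by
    intro ω
    rw [RCLike.ofReal_pow, ← RCLike.conj_mul, map_sum, Finset.sum_mul_sum]
    refine Finset.sum_congr rfl fun j _ => Finset.sum_congr rfl fun k _ => ?_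
    rw [map_mul]
    ring
  rw [← integral_ofReal]
  simp only [hpt]
  rw [integral_finsetSum _ fun j _ => integrable_finsetSum _ fun k _ => hi j k]
  simp only [dotProduct, mulVec, Finset.mul_sum]
  refine Finset.sum_congr rfl fun j _ => ?_
  rw [integral_finsetSum _ fun k _ => hi j k]
  refine Finset.sum_congr rfl fun k _ => ?_
  rw [integral_const_mul, gramMatrix, Pi.star_apply, RCLike.star_def]
  ring

theorem IsStationaryNoise.intervalIntegrable {Y : ℤ → Ω → 𝕜} {f : ℝ → ℝ}
    (hY : IsStationaryNoise P Y f) : IntervalIntegrable f volume (-Real.pi) Real.pi :=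
  (intervalIntegrable_iff_integrableOn_Icc_of_le (by linarith [Real.pi_pos])).mpr
    hY.density_integrable

open Matrix in
theorem IsStationaryNoise.integral_norm_sq {Y : ℤ → Ω → 𝕜} {f : ℝ → ℝ}
    (hY : IsStationaryNoise P Y f) {n : ℕ} (c : Fin (n + 1) → 𝕜) :
    ∫ ω, ‖∑ k, c k * Y ((k : ℕ) : ℤ) ω‖ ^ 2 ∂P = spectralForm f (weightPoly c) := by
  have h := congrArg (RCLike.map 𝕜 ℂ) (star_dotProduct_gramMatrix_mulVec hY.memLp c)
  rw [map_complex_ofReal] at h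
  apply Complex.ofReal_injective
  rw [← h, ofReal_spectralForm, integral_eval_mul_conj_eval hY.intervalIntegrable
    (natDegree_weightPoly_le c) (natDegree_weightPoly_le c), Finset.sum_range]
  simp only [dotProduct, mulVec, map_sum, Finset.mul_sum]
  refine Finset.sum_congr rfl fun j _ => ?_
  rw [Finset.sum_range]
  refine Finset.sum_congr rfl fun k _ => ?_
  have hcov := hY.cov ((j : ℕ) : ℤ) (((k : ℕ) : ℤ) - ((j : ℕ) : ℤ))
  rw [sub_add_cancel] at hcov
  rw [coeff_weightPoly, coeff_weightPoly, map_complex_mul, map_complex_mul, gramMatrix, hcov,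
    Pi.star_apply, RCLike.star_def, map_complex_conj]
  ring

/-- The variance of a linear unbiased estimator is the spectral form of its polynomial. -/
theorem IsStationaryNoise.estVar_eq {X Y : ℤ → Ω → 𝕜} {f : ℝ → ℝ} {m : 𝕜}
    (hY : IsStationaryNoise P Y f) (hX : ∀ t ω, X t ω = m + Y t ω) {n : ℕ}
    {c : Fin (n + 1) → 𝕜} (hc : ∑ k, c k = 1) :
    estVar P X m c = spectralForm f (weightPoly c) := by
  simp only [estVar, linEst_sub_mean hX hc]
  exact hY.integral_norm_sq c

theorem IsStationaryNoise.existsUnique_isBLUE {X Y : ℤ → Ω → 𝕜} {f : ℝ → ℝ} {m : 𝕜}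
    (hY : IsStationaryNoise P Y f) (hX : ∀ t ω, X t ω = m + Y t ω)
    (hpos : ∀ p : Polynomial ℂ, p ≠ 0 → 0 < spectralForm f p) (n : ℕ) :
    ∃! c : Fin (n + 1) → 𝕜, IsBLUE P X m c := by
  have hquad : ∀ c : Fin (n + 1) → 𝕜, RCLike.re (star c ⬝ᵥ (gramMatrix P Y n).mulVec c) =
      spectralForm f (weightPoly c) := by
    intro c
    rw [star_dotProduct_gramMatrix_mulVec hY.memLp, RCLike.ofReal_re, hY.integral_norm_sq]
  have h := existsUnique_forall_re_dotProduct_le (isHermitian_gramMatrix P Y n) (fun x hx => by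
    rw [hquad]
    exact hpos _ (weightPoly_ne_zero hx))
  refine (existsUnique_congr fun c => and_congr_right fun hc => forall₂_congr fun d hd => ?_).mp h
  rw [hquad, hquad, hY.estVar_eq hX hc, hY.estVar_eq hX hd]

theorem IsStationaryNoise.isBLUE_alphaWeights {X Y : ℤ → Ω → 𝕜} {α : ℝ} (hα : -(1 / 2) < α)
    {m : 𝕜} (hY : IsStationaryNoise P Y (fAlpha α)) (hX : ∀ t ω, X t ω = m + Y t ω) (n : ℕ) :
    IsBLUE P X m (alphaWeights 𝕜 α n) := by
  refine ⟨sum_alphaWeights hα n, fun d hd => ?_⟩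
  have h := blueVar_mul_le_spectralForm hα (natDegree_weightPoly_le d)
  rw [eval_one_weightPoly hd, norm_one, one_pow, mul_one] at h
  rwa [hY.estVar_eq hX (sum_alphaWeights hα n), hY.estVar_eq hX hd, weightPoly_alphaWeights hα,
    spectralForm_alphaPoly hα]

end Variance

/-! ### Asymptotic efficiency -/

section Asymptotic

variable {α : ℝ} {g : ℝ → ℝ}

theorem eventually_spectralForm_alphaPoly_div_lt (hα : -(1 / 2) < α)
    (hg : MemZB0Plus g) (hg0 : 0 < g 0)
    (hf : IntervalIntegrable (fun x => fAlpha α x * g x) volume (-Real.pi) Real.pi) {a : ℝ}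
    (ha : g 0 < a) :
    ∀ᶠ n in atTop, spectralForm (fun x => fAlpha α x * g x) (alphaPoly α n) / blueVar α n < a := by
  obtain ⟨A, hA1, hA2⟩ := exists_between ha
  obtain ⟨K, hK, hmaj⟩ := hg.exists_majorant hA1 (hg0.trans hA1).le
  have hlim : Tendsto (fun n => A + K * (1 - blueVar α (n + 1) / blueVar α n)) atTop
      (𝓝 (A + K * (1 - 1))) :=
    (((tendsto_blueVar_succ_div hα).const_sub 1).const_mul K).const_add A
  rw [sub_self, mul_zero, add_zero] at hlim
  filter_upwards [hlim.eventually_lt_const hA2] with n hn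
  refine lt_of_le_of_lt ?_ hn
  have hV := blueVar_pos hα n
  rw [div_le_iff₀ hV]
  refine (spectralForm_alphaPoly_le hα hf hK hmaj n).trans (le_of_eq ?_)
  field_simp

/-- The lower bound is uniform over all competitors: if `|Q|² ≤ g`, then `p * Q` is a competitor for
`f_α` of degree at most `n + Q.natDegree`, up to the factor `Q(1)`. -/
theorem eventually_lt_spectralForm_div (hα : -(1 / 2) < α) (hg : MemZB0Plus g)
    (hf : IntervalIntegrable (fun x => fAlpha α x * g x) volume (-Real.pi) Real.pi) {b : ℝ}
    (hb0 : 0 < b) (hb : b < g 0) :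
    ∀ᶠ n in atTop, ∀ p : Polynomial ℂ, p.natDegree ≤ n → p.eval 1 = 1 →
      b < spectralForm (fun x => fAlpha α x * g x) p / blueVar α n := by
  obtain ⟨B, hB1, hB2⟩ := exists_between hb
  obtain ⟨Q, hQ1, hQ⟩ := hg.exists_sharp_minorant (hb0.trans hB1) hB2
  have hlim := (tendsto_blueVar_add_div hα Q.natDegree).mul_const B
  rw [one_mul] at hlim
  filter_upwards [hlim.eventually_const_lt hB1] with n hn p hp hp1
  refine hn.trans_le ?_
  have h1 := blueVar_mul_le_spectralForm hα (n := n + Q.natDegree) (p := p * Q)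
    (Polynomial.natDegree_mul_le.trans (Nat.add_le_add_right hp _))
  rw [Polynomial.eval_mul, hp1, one_mul, hQ1] at h1
  rw [div_mul_eq_mul_div]
  exact div_le_div_of_nonneg_right (h1.trans (spectralForm_mul_le hα hf hQ p))
    (blueVar_pos hα n).le

/-- Any sequence squeezed between the optimal variance and that of the explicit weights has the
rate of `g 0 * blueVar α n`. -/
theorem tendsto_spectralForm_div_blueVar (hα : -(1 / 2) < α) (hg : MemZB0Plus g) (hg0 : 0 < g 0)
    (hf : IntervalIntegrable (fun x => fAlpha α x * g x) volume (-Real.pi) Real.pi)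
    {p : ℕ → Polynomial ℂ} (hdeg : ∀ n, (p n).natDegree ≤ n) (hp1 : ∀ n, (p n).eval 1 = 1)
    (hle : ∀ n, spectralForm (fun x => fAlpha α x * g x) (p n) ≤
      spectralForm (fun x => fAlpha α x * g x) (alphaPoly α n)) :
    Tendsto (fun n => spectralForm (fun x => fAlpha α x * g x) (p n) / blueVar α n) atTop
      (𝓝 (g 0)) := by
  refine tendsto_order.mpr ⟨fun b hb => ?_, fun a ha => ?_⟩
  · have hm : max b (g 0 / 2) < g 0 := max_lt hb (by linarith)
    filter_upwards [eventually_lt_spectralForm_div hα hg hf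
      (lt_max_of_lt_right (by linarith)) hm] with n hn
    exact (le_max_left _ _).trans_lt (hn _ (hdeg n) (hp1 n))
  · filter_upwards [eventually_spectralForm_alphaPoly_div_lt hα hg hg0 hf ha] with n hn
    exact (div_le_div_of_nonneg_right (hle n) (blueVar_pos hα n).le).trans_lt hn

end Asymptotic

end MeanEstimation
end

theorem theorem5p2 {𝕜 : Type u} [RCLike 𝕜] {Ω : Type v} [MeasurableSpace Ω]
    (P : Measure Ω) [IsProbabilityMeasure P]
    (α : ℝ) (hα : -(1 / 2) < α)
    (g : ℝ → ℝ) (hg : MeanEstimation.MemZB0Plus g) (hg0 : 0 < g 0)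
    (m : 𝕜) (X Y : ℤ → Ω → 𝕜)
    (hX : ∀ t ω, X t ω = m + Y t ω)
    (hY : MeanEstimation.IsStationaryNoise P Y (fun x => MeanEstimation.fAlpha α x * g x)) :
    -- existence and uniqueness of the BLUE for every sample size
    (∀ n : ℕ, ∃! c : Fin (n + 1) → 𝕜, MeanEstimation.IsBLUE P X m c) ∧
    -- the explicit estimator is linear unbiased, and it is the BLUE for the density `f_α`
    (∀ n : ℕ, ∑ k, MeanEstimation.alphaWeights 𝕜 α n k = 1) ∧
    (∀ (Ω' : Type v) [MeasurableSpace Ω'] (P' : Measure Ω') [IsProbabilityMeasure P']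
      (m' : 𝕜) (Y' : ℤ → Ω' → 𝕜),
      MeanEstimation.IsStationaryNoise P' Y' (MeanEstimation.fAlpha α) →
      ∀ n : ℕ, MeanEstimation.IsBLUE P' (fun t ω => m' + Y' t ω) m'
        (MeanEstimation.alphaWeights 𝕜 α n)) ∧
    ∀ c : (n : ℕ) → Fin (n + 1) → 𝕜, (∀ n, MeanEstimation.IsBLUE P X m (c n)) →
      -- the asymptotics of the variance of the BLUE
      ((fun n : ℕ => MeanEstimation.estVar P X m (c n)) ~[atTop]
        fun n : ℕ => (n : ℝ) ^ (-2 * α - 1) * Real.Gamma (2 * α + 1) * g 0 /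
          ProbabilityTheory.beta (α + 1) (α + 1)) ∧
      -- asymptotic efficiency of the explicit estimator
      Tendsto (fun n : ℕ => MeanEstimation.estVar P X m (c n) /
        MeanEstimation.estVar P X m (MeanEstimation.alphaWeights 𝕜 α n)) atTop (𝓝 1) := by
  open MeanEstimation in
  have hf := hY.intervalIntegrable
  have hpos : ∀ p : Polynomial ℂ, p ≠ 0 → 0 < spectralForm (fun x => fAlpha α x * g x) p := by
    intro p hp
    obtain ⟨Q, hQ1, hQ⟩ := hg.exists_sharp_minorant (half_pos hg0) (half_lt_self hg0)
    have hQ0 : Q ≠ 0 := by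
      rintro rfl
      rw [Polynomial.eval_zero, norm_zero] at hQ1
      linarith
    exact (spectralForm_fAlpha_pos hα (mul_ne_zero hp hQ0)).trans_le
      (spectralForm_mul_le hα hf hQ p)
  have hsum := sum_alphaWeights (𝕜 := 𝕜) hα
  refine ⟨hY.existsUnique_isBLUE hX hpos, hsum,
    fun Ω' _ P' _ m' Y' hY' n => hY'.isBLUE_alphaWeights hα (fun _ _ => rfl) n, fun c hc => ?_⟩
  have hVα : ∀ n, estVar P X m (alphaWeights 𝕜 α n) =
      spectralForm (fun x => fAlpha α x * g x) (alphaPoly α n) := fun n => by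
    rw [hY.estVar_eq hX (hsum n), weightPoly_alphaWeights hα]
  have hle : ∀ n, spectralForm (fun x => fAlpha α x * g x) (weightPoly (c n)) ≤
      spectralForm (fun x => fAlpha α x * g x) (alphaPoly α n) := fun n => by
    rw [← hVα, ← hY.estVar_eq hX (hc n).1]
    exact (hc n).2 _ (hsum n)
  have hlim := tendsto_spectralForm_div_blueVar hα hg hg0 hf
    (fun n => natDegree_weightPoly_le (c n)) (fun n => eval_one_weightPoly (hc n).1) hle
  have hlimα := tendsto_spectralForm_div_blueVar hα hg hg0 hf
    (natDegree_alphaPoly_le α) (eval_one_alphaPoly hα) (fun _ => le_rfl)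
  constructor
  · have h1 : (fun n : ℕ => estVar P X m (c n)) ~[atTop] fun n => g 0 * blueVar α n := by
      refine isEquivalent_of_tendsto_one ?_
      have := hlim.div_const (g 0)
      rw [div_self hg0.ne'] at this
      refine this.congr fun n => ?_
      rw [Pi.div_apply, hY.estVar_eq hX (hc n).1, div_div, mul_comm (g 0)]
    refine h1.trans ?_
    refine ((IsEquivalent.refl (u := fun _ : ℕ => g 0)).mul (blueVar_isEquivalent hα)).congr_right
      (Eventually.of_forall fun n => ?_)
    simp only [Pi.mul_apply]
    ring
  · have h := hlim.div hlimα hg0.ne'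
    rw [div_self hg0.ne'] at h
    refine h.congr fun n => ?_
    rw [Pi.div_apply, hY.estVar_eq hX (hc n).1, hVα,
      div_div_div_cancel_right₀ (blueVar_pos hα n).ne']
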